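/- Fix a finite relational vocabulary whose maximal arity is $2$, i.e. every relation symbol has arity at most $2$ and at least one has arity exactly $2$. For $n \geq 1$ let $\mathbf{S}_n$ be the set of all structures for this vocabulary with universe $[n] = \{1, \ldots, n\}$ (labelled structures). For a structure $\mathcal{M}$ let $\mathrm{Aut}(\mathcal{M})$ be its automorphism group. For a permutation $f$ of the universe let $\mathrm{Spt}(f)$ be the set of elements moved by $f$. Let $\mathrm{spt}(\mathcal{M}) = \max\{|\mathrm{Spt}(f)| : f \in \mathrm{Aut}(\mathcal{M})\}$, and let $\mathrm{spt}^*(\mathcal{M}) = \big|\bigcup_{f \in \mathrm{Aut}(\mathcal{M})} \mathrm{Spt}(f)\big|$ be the number of elements moved by at least one automorphism. Let $m \geq 2$ be an integer, and let $m' = m$ if $m$ is even and $m' = m+1$ otherwise. Let $\mathbf{S}_n(\mathrm{spt} \geq m) = \{\mathcal{M} \in \mathbf{S}_n : \mathrm{spt}(\mathcal{M}) \geq m\}$, and define $\mathbf{S}_n(\mathrm{spt}^* \geq m)$ in the same way with $\mathrm{spt}^*$. Then: (i) The proportion of $\mathcal{M} \in \mathbf{S}_n(\mathrm{spt} \geq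 m)$ such that $\mathrm{spt}^*(\mathcal{M}) = m'$ and $\mathrm{Aut}(\mathcal{M}) \cong (\mathbb{Z}_2)^i$ for some $i \in \{1, \ldots, m'/2\}$ converges to $1$ as $n \to \infty$. (ii) For every $i \in \{1, \ldots, m'/2\}$ there is a rational number $a_i$ with $0 < a_i \leq 1$, and with $a_i < 1$ if $m > 2$, such that the proportion of $\mathcal{M} \in \mathbf{S}_n(\mathrm{spt} \geq m)$ with $\mathrm{Aut}(\mathcal{M}) \cong (\mathbb{Z}_2)^i$ converges to $a_i$ as $n \to \infty$. (iii) Parts (i) and (ii) also hold with $\mathbf{S}_n(\mathrm{spt}^* \geq m)$ in place of $\mathbf{S}_n(\mathrm{spt} \geq m)$. -/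

import Mathlib

open Filter Topology
open scoped FirstOrder

/-- The automorphism group of an `L`-structure `M` with universe `A`, as a subgroup of the group of
all permutations of `A`. -/
def autGroup {L : FirstOrder.Language} {A : Type*} (M : L.Structure A) :
    Subgroup (Equiv.Perm A) where
  carrier := {f | letI := M; ∃ g : A ≃[L] A, g.toEquiv = f}
  mul_mem' := by
    let := M
    rintro _ _ ⟨g, rfl⟩ ⟨h, rfl⟩
    exact ⟨g.comp h, rfl⟩
  one_mem' := by
    let := M
    exact ⟨FirstOrder.Language.Equiv.refl L A, rfl⟩
  inv_mem' := by
    let := M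
    rintro _ ⟨g, rfl⟩
    exact ⟨g.symm, rfl⟩

/-- `spt M`: the largest number of elements moved by a single automorphism of `M`
(the maximum of a finite nonempty set of natural numbers). -/
noncomputable def spt {L : FirstOrder.Language} {n : ℕ} (M : L.Structure (Fin n)) : ℕ :=
  sSup {k | ∃ f ∈ autGroup M, f.support.card = k}

/-- `Spt* M`: the set of elements that are moved by some automorphism of `M`. -/
def SptStar {L : FirstOrder.Language} {n : ℕ} (M : L.Structure (Fin n)) : Set (Fin n) :=
  {a | ∃ f ∈ autGroup M, a ∈ f.support}

/-- `spt* M`: the number of elements that are moved by some automorphism of `M`. -/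
noncomputable def sptStar {L : FirstOrder.Language} {n : ℕ} (M : L.Structure (Fin n)) : ℕ :=
  (SptStar M).ncard

/-- The automorphism group of `M` is isomorphic, as an abstract group, to `(ℤ/2ℤ)^i`. -/
def AutIsoZ2Pow {L : FirstOrder.Language} {A : Type*} (M : L.Structure A) (i : ℕ) : Prop :=
  Nonempty (autGroup M ≃* Multiplicative (Fin i → ZMod 2))

/-- A property of finite structures with universe `Fin n`, for all `n`. -/
abbrev StructureProperty (L : FirstOrder.Language) : Type _ :=
  ∀ n : ℕ, L.Structure (Fin n) → Prop

/-- The proportion, among the labelled structures with universe `Fin n` that have property `C`,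
of those that also have property `P`. -/
noncomputable def proportion {L : FirstOrder.Language} (C P : StructureProperty L) (n : ℕ) : ℝ :=
  (Nat.card {M : L.Structure (Fin n) // C n M ∧ P n M} : ℝ) /
    (Nat.card {M : L.Structure (Fin n) // C n M} : ℝ)

/-- Almost all finite structures with property `C` have property `P`. -/
def AlmostAll {L : FirstOrder.Language} (C P : StructureProperty L) : Prop :=
  Tendsto (proportion C P) atTop (𝓝 1)

/-- The structures with `spt ≥ m`. -/
def SptGE (L : FirstOrder.Language) (m : ℕ) : StructureProperty L :=
  fun _ M => m ≤ spt M

/-- The structures with `spt* ≥ m`. -/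
def SptStarGE (L : FirstOrder.Language) (m : ℕ) : StructureProperty L :=
  fun _ M => m ≤ sptStar M

/-- `m' = m` if `m` is even, and `m' = m + 1` otherwise. -/
def evenCeil (m : ℕ) : ℕ := if Even m then m else m + 1

/-! A structure is a set of atoms, so there are 2^N(n) structures on n elements, where N is
`numAtoms`, of degree 2 in n. Suppose s elements are moved and they form c orbits. Because arities
are at most 2, an atom with an entry outside the moved set keeps its truth value when its moved
entry is replaced by an orbit representative (`mem_frame_of_orbit`). Up to a constant factor for the
atoms inside the moved set, at most n^s * 2^N(n-(s-c)) structures arise in this way.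

Write m' = 2k. Then s ≥ 2k-1 and 2c ≤ s force s-c ≥ k. If s-c > k, a factor exponential in n is
lost. If s-c = k, then either s = 2k and c = k, or s = 2k-1 and c = k-1, which loses a factor n.
This analysis needs s bounded. When some automorphism moves more than 8k elements, a union bound
over permutations (`sq_card_aut_le`) is used instead; otherwise averaging over the group gives s ≤
16k (`ncard_moved_le`). So in almost all structures the moved elements form k orbits of size 2.

In that case the automorphism group is a subspace of (ℤ/2)^k, the flips preserving the structure A
induced on the k pairs (`Adapted.nonempty_mulEquiv`). The rest of the structure is chosen
independently of A (`card_frame_comap`), so A is asymptotically uniform on a finite set Q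
(`tendsto_card_class`) and every limit is a ratio of cardinalities of finite sets. For `spt`, Q
requires the all-ones flip; for `spt*`, it requires that every pair be flipped by something. Block
structures realise each dimension from 1 to k (`exists_finrank_flipSubmodule`), so the limits are
positive, and less than 1 once k ≥ 2. -/

/-! ### Atoms, and automorphisms of sets of atoms. -/

/-- The atomic facts about elements of `V` for relation symbols of arities `ar`. -/
abbrev Atom {R : Type*} (ar : R → ℕ) (V : Type*) := Σ r : R, (Fin (ar r) → V)

namespace Atom
variable {R : Type*} {ar : R → ℕ} {V W U : Type*}

/-- Relabel an atom along a map. -/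
def map (f : V → W) (a : Atom ar V) : Atom ar W := ⟨a.1, f ∘ a.2⟩

/-- All entries of the atom are in `S`. -/
def LiesIn (a : Atom ar V) (S : Set V) : Prop := ∀ i, a.2 i ∈ S

theorem map_map (f : V → W) (g : W → U) (a : Atom ar V) : (a.map f).map g = a.map (g ∘ f) := rfl

theorem map_injective {f : V → W} (hf : f.Injective) :
    Function.Injective (map f : Atom ar V → Atom ar W) := by
  rintro ⟨r, x⟩ ⟨s, y⟩ h
  obtain rfl : r = s := congrArg Sigma.fst h
  have h' := eq_of_heq (Sigma.mk.inj h).2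
  have : x = y := hf.comp_left h'
  rw [this]

theorem map_surjective {f : V → W} (hf : f.Surjective) :
    Function.Surjective (map f : Atom ar V → Atom ar W) := by
  rintro ⟨r, x⟩
  obtain ⟨y, hy⟩ := hf.comp_left (α := Fin (ar r)) x
  exact ⟨⟨r, y⟩, by rw [← hy]; rfl⟩

theorem liesIn_range_iff {f : V → W} {a : Atom ar W} :
    a.LiesIn (Set.range f) ↔ ∃ b : Atom ar V, b.map f = a := by
  constructor
  · intro h
    choose y hy using h
    exact ⟨⟨a.1, y⟩, by rcases a with ⟨r, x⟩; exact congrArg _ (funext hy)⟩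
  · rintro ⟨b, rfl⟩ i
    exact ⟨_, rfl⟩

theorem map_eq_map {f g : V → W} {a : Atom ar V} (h : ∀ i, f (a.2 i) = g (a.2 i)) :
    a.map f = a.map g := congrArg (Sigma.mk a.1) (funext h)

theorem map_eq_self_iff {f : V → V} {a : Atom ar V} :
    a.map f = a ↔ a.LiesIn {v | f v = v} := by
  rcases a with ⟨r, x⟩
  refine ⟨fun h i => ?_, fun h => map_eq_map (g := id) h⟩
  exact congrFun (eq_of_heq (Sigma.mk.inj h).2) i

end Atom

/-- The number of atoms over a universe with `n` elements. -/
def numAtoms {R : Type*} [Fintype R] (ar : R → ℕ) (n : ℕ) : ℕ := ∑ r, n ^ ar r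

section Counting
variable {R : Type*} [Fintype R] {ar : R → ℕ} {V ι : Type*}

theorem numAtoms_mono : Monotone (numAtoms ar) := fun _ _ h =>
  Finset.sum_le_sum fun _ _ => Nat.pow_le_pow_left h _

theorem card_atom [Finite V] : Nat.card (Atom ar V) = numAtoms ar (Nat.card V) := by
  rw [Nat.card_sigma]
  exact Finset.sum_congr rfl fun r _ => by simp [Nat.card_fun]

theorem card_set_eq (α : Type*) [Finite α] : Nat.card (Set α) = 2 ^ Nat.card α := by
  have := Fintype.ofFinite α
  simp [Nat.card_eq_fintype_card]

theorem card_set_atom [Finite V] :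
    Nat.card (Set (Atom ar V)) = 2 ^ numAtoms ar (Nat.card V) := by
  rw [card_set_eq, card_atom]

end Counting

/-- Automorphisms of a structure given by its set of atoms. -/
def aut {R : Type*} {ar : R → ℕ} {V : Type*} (X : Set (Atom ar V)) :
    Subgroup (Equiv.Perm V) where
  carrier := {f | ∀ a : Atom ar V, a.map f ∈ X ↔ a ∈ X}
  mul_mem' := fun {f g} hf hg a => (hf (a.map g)).trans (hg a)
  one_mem' := fun _ => Iff.rfl
  inv_mem' := fun {f} hf a => by
    rw [← hf (a.map _), Atom.map_map]
    rw [← Equiv.Perm.coe_mul, mul_inv_cancel]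
    rfl

/-- The elements moved by some automorphism. -/
def moved {R : Type*} {ar : R → ℕ} {V : Type*} (X : Set (Atom ar V)) : Set V :=
  {v | ∃ f ∈ aut X, f v ≠ v}

/-! ### Frames: structures determined by orbit representatives. -/

section Frames
variable {R : Type*} {ar : R → ℕ} {V ι : Type*}

/-- The map `ρ` transported along `e` and extended by the identity. -/
noncomputable def collapse (e : ι ↪ V) (ρ : ι → ι) : V → V := Function.extend e (e ∘ ρ) id

theorem collapse_apply (e : ι ↪ V) (ρ : ι → ι) (p : ι) : collapse e ρ (e p) = e (ρ p) :=
  e.injective.extend_apply _ _ _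

theorem collapse_of_notMem {e : ι ↪ V} (ρ : ι → ι) {v : V} (h : v ∉ Set.range e) :
    collapse e ρ v = v := Function.extend_apply' _ _ _ h

/-- Structures which, on atoms not inside the range of `e`, are invariant under collapsing
along `ρ`. -/
def Frame (ar : R → ℕ) (e : ι ↪ V) (ρ : ι → ι) : Set (Set (Atom ar V)) :=
  {X | ∀ a : Atom ar V, ¬ a.LiesIn (Set.range e) → (a.map (collapse e ρ) ∈ X ↔ a ∈ X)}

theorem not_liesIn_map {e : ι ↪ V} {f : V → V} (hf : ∀ v ∉ Set.range e, f v = v)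
    {a : Atom ar V} (ha : ¬ a.LiesIn (Set.range e)) : ¬ (a.map f).LiesIn (Set.range e) := by
  intro h
  apply ha
  intro i
  by_contra hi
  exact hi (hf _ hi ▸ h i)

/-- Outside the range of `e`, the truth value of an atom is that of its collapse, an atom over the
range of `collapse e ρ`; the atoms inside the range of `e` are free. -/
theorem card_frame_le [Fintype R] [Finite V] (e : ι ↪ V) (ρ : ι → ι) :
    Nat.card (Frame ar e ρ) ≤
      2 ^ numAtoms ar (Nat.card (Set.range (collapse e ρ))) * 2 ^ numAtoms ar (Nat.card ι) := by
  have : Finite ι := Finite.of_injective e e.injective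
  rw [← card_set_atom, ← card_set_atom, ← Nat.card_prod]
  refine Nat.card_le_card_of_injective
    (fun X => (Atom.map Subtype.val ⁻¹' X.1, Atom.map e ⁻¹' X.1)) ?_
  rintro ⟨X, hX⟩ ⟨Y, hY⟩ h
  simp only [Prod.mk.injEq, Set.ext_iff, Set.mem_preimage] at h
  ext a
  by_cases ha : a.LiesIn (Set.range e)
  · obtain ⟨b, rfl⟩ := Atom.liesIn_range_iff.1 ha
    exact h.2 b
  · change a ∈ X ↔ a ∈ Y
    rw [← hX a ha, ← hY a ha]
    exact h.1 (a.map (Set.rangeFactorization _))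

/-- Since the collapse is idempotent, pulling back any set of atoms over its range gives a
collapse-invariant structure. -/
theorem le_card_frame [Fintype R] [Finite V] (e : ι ↪ V) (ρ : ι → ι) (hρ : ∀ p, ρ (ρ p) = ρ p) :
    2 ^ numAtoms ar (Nat.card (Set.range (collapse e ρ))) ≤ Nat.card (Frame ar e ρ) := by
  rw [← card_set_atom]
  have hcc : ∀ v, collapse e ρ (collapse e ρ v) = collapse e ρ v := by
    intro v
    by_cases hv : v ∈ Set.range e
    · obtain ⟨p, rfl⟩ := hv
      simp [collapse_apply, hρ]
    · simp [collapse_of_notMem ρ hv]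
  refine Nat.card_le_card_of_injective (fun Y =>
    ⟨Atom.map (Set.rangeFactorization (collapse e ρ)) ⁻¹' Y, fun a _ => ?_⟩) ?_
  · rw [Set.mem_preimage, Set.mem_preimage, Atom.map_map]
    exact iff_of_eq (congrArg (· ∈ Y) (Atom.map_eq_map fun i => Subtype.ext (hcc _)))
  · intro Y Z h
    exact (Atom.map_surjective Set.rangeFactorization_surjective).preimage_injective
      (congrArg Subtype.val h)

theorem card_range_collapse_le [Finite V] (e : ι ↪ V) (ρ : ι → ι) :
    Nat.card (Set.range (collapse e ρ)) ≤
      Nat.card V - (Nat.card ι - Nat.card (Set.range ρ)) := by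
  have : Finite ι := Finite.of_injective e e.injective
  have h1 : Set.range (collapse e ρ) ⊆ (e '' (Set.range ρ)ᶜ)ᶜ := by
    rintro _ ⟨v, rfl⟩
    by_cases hv : v ∈ Set.range e
    · obtain ⟨p, rfl⟩ := hv
      rw [collapse_apply]
      rintro ⟨q, hq, hqp⟩
      exact hq ⟨p, (e.injective hqp).symm⟩
    · rw [collapse_of_notMem ρ hv]
      rintro ⟨q, -, hq⟩
      exact hv ⟨q, hq⟩
  have h2 := Set.ncard_le_ncard h1 (Set.toFinite _)
  rwa [Set.ncard_compl, Set.ncard_image_of_injective _ e.injective, Set.ncard_compl] at h2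

theorem le_card_range_collapse [Finite V] (e : ι ↪ V) (ρ : ι → ι) (hρ : ∀ p, ρ (ρ p) = ρ p) :
    Nat.card V - (Nat.card ι - Nat.card (Set.range ρ)) ≤
      Nat.card (Set.range (collapse e ρ)) := by
  have : Finite ι := Finite.of_injective e e.injective
  have h1 : (e '' (Set.range ρ)ᶜ)ᶜ ⊆ Set.range (collapse e ρ) := by
    intro v hv
    refine ⟨v, ?_⟩
    by_cases hv' : v ∈ Set.range e
    · obtain ⟨p, rfl⟩ := hv'
      rw [collapse_apply]
      have : p ∈ Set.range ρ := by
        by_contra h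
        exact hv ⟨p, h, rfl⟩
      obtain ⟨q, rfl⟩ := this
      rw [hρ]
    · exact collapse_of_notMem ρ hv'
  have h2 := Set.ncard_le_ncard h1 (Set.toFinite _)
  rwa [Set.ncard_compl, Set.ncard_image_of_injective _ e.injective, Set.ncard_compl] at h2

/-- The frame condition speaks only of atoms not inside the range of `e`, and collapsing keeps them
there. The part inside is therefore an independent choice, which makes the count an exact product.
-/
theorem card_frame_comap (e : ι ↪ V) (ρ : ι → ι) (Q : Set (Set (Atom ar ι))) :
    Nat.card {X // X ∈ Frame ar e ρ ∧ Atom.map e ⁻¹' X ∈ Q} =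
      Nat.card Q * Nat.card {X // X ∈ Frame ar e ρ ∧ Atom.map e ⁻¹' X = ∅} := by
  have hmap : ∀ a : Atom ar V, ¬ a.LiesIn (Set.range e) →
      ¬ (a.map (collapse e ρ)).LiesIn (Set.range e) := fun a ha =>
    not_liesIn_map (fun v hv => collapse_of_notMem ρ hv) ha
  have hno : ∀ (a : Atom ar V) (A : Set (Atom ar ι)), ¬ a.LiesIn (Set.range e) →
      a ∉ Atom.map e '' A := by
    rintro a A ha ⟨b, -, hb⟩
    exact ha (Atom.liesIn_range_iff.2 ⟨b, hb⟩)
  have hin : ∀ b : Atom ar ι, (b.map e).LiesIn (Set.range e) := fun b i => ⟨_, rfl⟩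
  rw [← Nat.card_prod]
  refine Nat.card_congr
    { toFun := fun X => (⟨Atom.map e ⁻¹' X.1, X.2.2⟩,
        ⟨X.1 ∩ {a | ¬ a.LiesIn (Set.range e)}, ?_, ?_⟩)
      invFun := fun Y => ⟨Atom.map e '' Y.1.1 ∪ Y.2.1, ?_, ?_⟩
      left_inv := ?_
      right_inv := ?_ }
  · intro a ha
    have := X.2.1 a ha
    simp only [Set.mem_inter_iff, Set.mem_ofPred_eq, hmap a ha, ha, this]
  · ext b
    simp [hin b]
  · intro a ha
    have := Y.2.2.1 a ha
    simp only [Set.mem_union, hno a _ ha, hno _ _ (hmap a ha), false_or, this]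
  · have : Atom.map e ⁻¹' (Atom.map e '' Y.1.1 ∪ Y.2.1) = Y.1.1 := by
      rw [Set.preimage_union, Y.2.2.2, Set.union_empty,
        Set.preimage_image_eq _ (Atom.map_injective e.injective)]
    rw [this]
    exact Y.1.2
  · rintro ⟨X, hX⟩
    ext a
    by_cases ha : a.LiesIn (Set.range e)
    · obtain ⟨b, rfl⟩ := Atom.liesIn_range_iff.1 ha
      simp [(Atom.map_injective e.injective).mem_set_image, hin b]
    · simp only [Set.mem_union, hno a _ ha, false_or, Set.mem_inter_iff, Set.mem_ofPred_eq, ha,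
        not_false_eq_true, and_true]
  · rintro ⟨⟨A, hA⟩, ⟨Y, hY, hY'⟩⟩
    have h0 : ∀ b : Atom ar ι, b.map e ∉ Y := fun b hb => by
      have : b ∈ Atom.map e ⁻¹' Y := hb
      rw [hY'] at this
      exact this
    refine Prod.ext (Subtype.ext ?_) (Subtype.ext ?_)
    · change Atom.map e ⁻¹' (Atom.map e '' A ∪ Y) = A
      rw [Set.preimage_union, hY', Set.union_empty,
        Set.preimage_image_eq _ (Atom.map_injective e.injective)]
    · ext a
      by_cases ha : a.LiesIn (Set.range e)
      · obtain ⟨b, rfl⟩ := Atom.liesIn_range_iff.1 ha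
        simp [hin b, h0 b]
      · simp only [Set.mem_union, hno a _ ha, false_or, Set.mem_inter_iff, Set.mem_ofPred_eq, ha,
          not_false_eq_true, and_true]

/-- If `range e` is the set of moved elements and `ρ` moves elements inside their orbits, then the
structure is in the frame of `e` and `ρ`; this is where binary arity matters. -/
theorem mem_frame_of_orbit (har : ∀ r, ar r ≤ 2) {X : Set (Atom ar V)} (e : ι ↪ V) (ρ : ι → ι)
    (h : Set.range e = moved X) (hρ : ∀ p, ∃ f ∈ aut X, f (e p) = e (ρ p)) :
    X ∈ Frame ar e ρ := by
  intro a ha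
  simp only [Atom.LiesIn, not_forall] at ha
  obtain ⟨i, hi⟩ := ha
  have hfix : ∀ f ∈ aut X, ∀ v ∉ Set.range e, f v = v := by
    intro f hf v hv
    by_contra hne
    exact hv (h ▸ ⟨f, hf, hne⟩)
  by_cases hj : ∃ j, a.2 j ∈ Set.range e
  · obtain ⟨j, p, hp⟩ := hj
    obtain ⟨f, hf, hfp⟩ := hρ p
    rw [← hf a]
    refine iff_of_eq (congrArg (· ∈ X) (Atom.map_eq_map fun l => ?_))
    have hij : i ≠ j := by
      rintro rfl
      exact hi ⟨p, hp⟩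
    have hl : l = i ∨ l = j := by
      have := har a.1
      have := i.2; have := j.2; have := l.2
      simp only [Fin.ext_iff, ne_eq] at hij ⊢
      omega
    rcases hl with rfl | rfl
    · rw [hfix f hf _ hi, collapse_of_notMem _ hi]
    · rw [← hp, collapse_apply, hfp]
  · push Not at hj
    refine iff_of_eq (congrArg (· ∈ X) (Atom.map_eq_map (g := id) fun l => ?_))
    exact collapse_of_notMem _ (hj l)

end Frames

/-! ### Flips of pairs as vectors over ℤ/2. -/

section Flip
variable {k : ℕ}

/-- Exchange the two elements of the `j`-th pair whenever `v j ≠ 0`. -/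
def pairFlip (v : Fin k → ZMod 2) : Equiv.Perm (Fin k × ZMod 2) where
  toFun p := (p.1, p.2 + v p.1)
  invFun p := (p.1, p.2 - v p.1)
  left_inv p := by simp
  right_inv p := by simp

theorem pairFlip_apply (v : Fin k → ZMod 2) (p : Fin k × ZMod 2) : pairFlip v p = (p.1, p.2 + v p.1) := rfl

theorem pairFlip_add (v w : Fin k → ZMod 2) : pairFlip (v + w) = pairFlip v * pairFlip w := by
  ext p : 1
  simp [pairFlip_apply, add_left_comm, add_comm]

theorem pairFlip_zero : pairFlip (0 : Fin k → ZMod 2) = 1 := by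
  ext p : 1
  simp [pairFlip_apply]

theorem pairFlip_injective : Function.Injective (pairFlip : (Fin k → ZMod 2) → _) := by
  intro v w h
  ext1 j
  have := congrArg (fun f => (f (j, 0)).2) h
  simpa [pairFlip_apply] using this

variable {R : Type*} {ar : R → ℕ}

/-- The flips that are automorphisms, as a subspace of `(ℤ/2)^k`. -/
def flipSubmodule (A : Set (Atom ar (Fin k × ZMod 2))) : Submodule (ZMod 2) (Fin k → ZMod 2) :=
  AddSubgroup.toZModSubmodule 2
    { carrier := {v | pairFlip v ∈ aut A}
      add_mem' := fun {v w} hv hw => by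
        change pairFlip (v + w) ∈ aut A
        rw [pairFlip_add]
        exact mul_mem hv hw
      zero_mem' := by
        change pairFlip 0 ∈ aut A
        rw [pairFlip_zero]
        exact one_mem _
      neg_mem' := fun {v} hv => by
        have : -v = v := by
          ext1 j
          exact ZMod.neg_eq_self_mod_two _
        rwa [this] }

end Flip

/-! ### Structures whose nontrivial orbits are k pairs. -/

section Adapted
variable {k : ℕ} {R : Type*} {ar : R → ℕ} {V : Type*}

/-- The map choosing the first element of each pair. -/
def pairBase (p : Fin k × ZMod 2) : Fin k × ZMod 2 := (p.1, 0)

/-- `e` enumerates the moved elements so that the orbits are the pairs. -/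
def Adapted (e : Fin k × ZMod 2 ↪ V) (X : Set (Atom ar V)) : Prop :=
  Set.range e = moved X ∧ ∀ p q, (∃ f ∈ aut X, f (e p) = e q) ↔ p.1 = q.1

/-- No pair is fixed by all flips that are automorphisms. -/
def FlipsCover (A : Set (Atom ar (Fin k × ZMod 2))) : Prop :=
  ∀ j, ∃ v ∈ flipSubmodule A, v j ≠ 0

theorem Adapted.mem_frame (har : ∀ r, ar r ≤ 2) {e : Fin k × ZMod 2 ↪ V} {X : Set (Atom ar V)}
    (h : Adapted e X) : X ∈ Frame ar e pairBase :=
  mem_frame_of_orbit har e _ h.1 fun p => (h.2 p (pairBase p)).2 rfl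

/-- Collapsing to the base point of each pair forgets the coordinate that a flip changes, so atoms
outside the range impose no condition on the flip. -/
theorem viaEmbedding_mem_aut {e : Fin k × ZMod 2 ↪ V} {X : Set (Atom ar V)}
    (hX : X ∈ Frame ar e pairBase) {v : Fin k → ZMod 2}
    (hv : v ∈ flipSubmodule (Atom.map e ⁻¹' X)) : (pairFlip v).viaEmbedding e ∈ aut X := by
  intro a
  by_cases ha : a.LiesIn (Set.range e)
  · obtain ⟨b, rfl⟩ := Atom.liesIn_range_iff.1 ha
    refine Iff.trans ?_ (hv b)
    rw [Set.mem_preimage, Atom.map_map, Atom.map_map]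
    exact iff_of_eq (congrArg (· ∈ X) (Atom.map_eq_map fun i =>
      Equiv.Perm.viaEmbedding_apply _ _ _))
  · rw [← hX a ha, ← hX (a.map _)]
    · rw [Atom.map_map]
      refine iff_of_eq (congrArg (· ∈ X) (Atom.map_eq_map fun i => ?_))
      simp only [Function.comp_apply]
      by_cases hi : a.2 i ∈ Set.range e
      · obtain ⟨p, hp⟩ := hi
        rw [← hp, Equiv.Perm.viaEmbedding_apply, collapse_apply, collapse_apply]
        rfl
      · rw [Equiv.Perm.viaEmbedding_apply_of_notMem _ _ _ hi]
    · exact not_liesIn_map (fun v hv => Equiv.Perm.viaEmbedding_apply_of_notMem _ _ _ hv) ha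

theorem mem_flipSubmodule_of_viaEmbedding {e : Fin k × ZMod 2 ↪ V} {X : Set (Atom ar V)}
    {v : Fin k → ZMod 2} (hv : (pairFlip v).viaEmbedding e ∈ aut X) :
    v ∈ flipSubmodule (Atom.map e ⁻¹' X) := by
  intro b
  rw [Set.mem_preimage, Set.mem_preimage, ← hv (b.map e), Atom.map_map, Atom.map_map]
  exact iff_of_eq (congrArg (· ∈ X) (Atom.map_eq_map fun i =>
      (Equiv.Perm.viaEmbedding_apply _ _ _).symm))

/-- An automorphism fixes everything outside the pairs and maps each pair to itself, and every
permutation of ℤ/2 is a translation. -/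
theorem Adapted.exists_pairFlip {e : Fin k × ZMod 2 ↪ V} {X : Set (Atom ar V)}
    (h : Adapted e X) {f : Equiv.Perm V} (hf : f ∈ aut X) :
    ∃ v, v ∈ flipSubmodule (Atom.map e ⁻¹' X) ∧ (pairFlip v).viaEmbedding e = f := by
  have hfix : ∀ v ∉ Set.range e, f v = v := by
    intro v hv
    by_contra hne
    exact hv (h.1 ▸ ⟨f, hf, hne⟩)
  have hmem : ∀ p, ∃ x, f (e p) = e (p.1, x) := by
    intro p
    have : f (e p) ∈ Set.range e := by
      by_contra hv
      exact hv ((f.injective (hfix _ hv)).symm ▸ ⟨p, rfl⟩)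
    obtain ⟨q, hq⟩ := this
    have := (h.2 p q).1 ⟨f, hf, hq.symm⟩
    exact ⟨q.2, by rw [this, ← hq]⟩
  choose w hw using hmem
  have hne : ∀ j, w (j, 1) ≠ w (j, 0) := by
    intro j hj
    have := f.injective ((hw (j, 1)).trans ((congrArg (fun x => e (j, x)) hj).trans
      (hw (j, 0)).symm))
    simpa using e.injective this
  have key : (pairFlip fun j => w (j, 0)).viaEmbedding e = f := by
    ext v
    by_cases hv : v ∈ Set.range e
    · obtain ⟨⟨j, x⟩, rfl⟩ := hv
      rw [Equiv.Perm.viaEmbedding_apply, hw, pairFlip_apply]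
      congr 2
      have h01 : ∀ x a b : ZMod 2, b ≠ a → x + a = if x = 0 then a else b := by decide
      rw [h01 x _ _ (hne j)]
      have hx : x = 0 ∨ x = 1 := by revert x; decide
      rcases hx with rfl | rfl <;> simp
    · rw [Equiv.Perm.viaEmbedding_apply_of_notMem _ _ _ hv, hfix v hv]
  exact ⟨_, mem_flipSubmodule_of_viaEmbedding (key ▸ hf), key⟩

theorem pairFlip_viaEmbedding_injective (e : Fin k × ZMod 2 ↪ V) :
    Function.Injective fun v : Fin k → ZMod 2 => (pairFlip v).viaEmbedding e := by
  intro v w h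
  apply pairFlip_injective
  ext p : 1
  apply e.injective
  rw [← Equiv.Perm.viaEmbedding_apply, ← Equiv.Perm.viaEmbedding_apply]
  exact congrArg (fun f : Equiv.Perm V => f (e p)) h

/-- If `e` is adapted, the automorphism group is the group of flips preserving the structure
induced on the pairs. -/
theorem Adapted.nonempty_mulEquiv (har : ∀ r, ar r ≤ 2) {e : Fin k × ZMod 2 ↪ V}
    {X : Set (Atom ar V)} (h : Adapted e X) :
    Nonempty (Multiplicative (flipSubmodule (Atom.map e ⁻¹' X)) ≃* aut X) := by
  let φ : Multiplicative (flipSubmodule (Atom.map e ⁻¹' X)) →* aut X :=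
    { toFun := fun v => ⟨(pairFlip v.toAdd.1).viaEmbedding e,
        viaEmbedding_mem_aut (h.mem_frame har) v.toAdd.2⟩
      map_one' := by
        apply Subtype.ext
        change (pairFlip 0).viaEmbedding e = 1
        rw [pairFlip_zero]
        exact map_one (Equiv.Perm.viaEmbeddingHom e)
      map_mul' := fun v w => by
        apply Subtype.ext
        change (pairFlip (v.toAdd.1 + w.toAdd.1)).viaEmbedding e = _
        rw [pairFlip_add]
        exact map_mul (Equiv.Perm.viaEmbeddingHom e) _ _ }
  refine ⟨MulEquiv.ofBijective φ ⟨fun v w hvw => ?_, fun f => ?_⟩⟩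
  · exact Subtype.ext (pairFlip_viaEmbedding_injective e (congrArg Subtype.val hvw))
  · obtain ⟨v, hv, hvf⟩ := h.exists_pairFlip f.2
    exact ⟨Multiplicative.ofAdd ⟨v, hv⟩, Subtype.ext hvf⟩

theorem Adapted.flipsCover {e : Fin k × ZMod 2 ↪ V} {X : Set (Atom ar V)}
    (h : Adapted e X) : FlipsCover (Atom.map e ⁻¹' X) := by
  intro j
  obtain ⟨f, hf, hfj⟩ := (h.2 (j, 0) (j, 1)).2 rfl
  obtain ⟨v, hv, rfl⟩ := h.exists_pairFlip hf
  refine ⟨v, hv, fun h0 => ?_⟩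
  rw [Equiv.Perm.viaEmbedding_apply] at hfj
  have := congrArg Prod.snd (e.injective hfj)
  simp [pairFlip_apply, h0] at this

theorem exists_aut_of_flipsCover {e : Fin k × ZMod 2 ↪ V} {X : Set (Atom ar V)}
    (hX : X ∈ Frame ar e pairBase) (h : FlipsCover (Atom.map e ⁻¹' X)) (j : Fin k) (x y : ZMod 2) :
    ∃ f ∈ aut X, f (e (j, x)) = e (j, y) := by
  by_cases hxy : x = y
  · exact ⟨1, one_mem _, by rw [hxy]; rfl⟩
  · obtain ⟨v, hv, hj⟩ := h j
    refine ⟨_, viaEmbedding_mem_aut hX hv, ?_⟩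
    rw [Equiv.Perm.viaEmbedding_apply, pairFlip_apply]
    have : ∀ x y a : ZMod 2, x ≠ y → a ≠ 0 → x + a = y := by decide
    rw [this x y _ hxy hj]

theorem range_subset_moved {e : Fin k × ZMod 2 ↪ V} {X : Set (Atom ar V)}
    (hX : X ∈ Frame ar e pairBase) (h : FlipsCover (Atom.map e ⁻¹' X)) :
    Set.range e ⊆ moved X := by
  rintro _ ⟨⟨j, x⟩, rfl⟩
  obtain ⟨f, hf, hfx⟩ := exists_aut_of_flipsCover hX h j x (x + 1)
  refine ⟨f, hf, fun h' => ?_⟩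
  rw [h'] at hfx
  simpa using e.injective hfx

theorem Adapted.ncard_moved {e : Fin k × ZMod 2 ↪ V} {X : Set (Atom ar V)} (h : Adapted e X) :
    (moved X).ncard = 2 * k := by
  rw [← h.1, ← Set.image_univ, Set.ncard_image_of_injective _ e.injective, Set.ncard_univ,
    Nat.card_prod]
  simp [mul_comm]

/-- The range of `e` consists of moved elements, and `e'` shows that there are only 2k of them. An
orbit meeting two pairs of `e` would have three elements, whereas the orbits are the pairs of `e'`.
This turns framed enumerations into adapted ones in the double count. -/
theorem Adapted.of_flipsCover [Finite V] {e e' : Fin k × ZMod 2 ↪ V} {X : Set (Atom ar V)}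
    (h' : Adapted e' X) (hX : X ∈ Frame ar e pairBase) (h : FlipsCover (Atom.map e ⁻¹' X)) :
    Adapted e X := by
  have hr : Set.range e = moved X := by
    apply Set.eq_of_subset_of_ncard_le (range_subset_moved hX h) _ (Set.toFinite _)
    rw [h'.ncard_moved, ← Set.image_univ, Set.ncard_image_of_injective _ e.injective,
      Set.ncard_univ, Nat.card_prod]
    simp [mul_comm]
  refine ⟨hr, fun p q => ⟨?_, fun hpq => ?_⟩⟩
  · rintro ⟨f, hf, hfp⟩
    by_contra hne
    -- three distinct elements in one orbit contradict that the orbits are pairs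
    obtain ⟨g, hg, hgp⟩ := exists_aut_of_flipsCover hX h p.1 p.2 (p.2 + 1)
    have hm : ∀ p, ∃ s, e' s = e p := fun p => by
      have : e p ∈ Set.range e' := by
        rw [h'.1, ← hr]
        exact ⟨p, rfl⟩
      exact this
    obtain ⟨s, hs⟩ := hm p
    obtain ⟨t, ht⟩ := hm q
    obtain ⟨u, hu⟩ := hm (p.1, p.2 + 1)
    have h1 := (h'.2 s t).1 ⟨f, hf, by rw [hs, ht, hfp]⟩
    have h2 := (h'.2 s u).1 ⟨g, hg, by rw [hs, hu]; exact hgp⟩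
    have hst : s ≠ t := by
      rintro rfl
      exact hne (congrArg Prod.fst (e.injective (hs.symm.trans ht)))
    have hsu : s ≠ u := by
      rintro rfl
      have := congrArg Prod.snd (e.injective (hs.symm.trans hu))
      simp at this
    have htu : t ≠ u := by
      rintro rfl
      exact hne (congrArg Prod.fst (e.injective (ht.symm.trans hu))).symm
    obtain ⟨s1, s2⟩ := s
    obtain ⟨t1, t2⟩ := t
    obtain ⟨u1, u2⟩ := u
    obtain rfl : s1 = t1 := h1
    obtain rfl : s1 = u1 := h2
    have h3 : ∀ x y z : ZMod 2, x ≠ y → x ≠ z → y ≠ z → False := by decide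
    exact h3 s2 t2 u2 (fun h => hst (by rw [h])) (fun h => hsu (by rw [h]))
      (fun h => htu (by rw [h]))
  · obtain ⟨f, hf, hfp⟩ := exists_aut_of_flipsCover hX h p.1 p.2 q.2
    exact ⟨f, hf, hfp.trans (by rw [hpq])⟩

/-- The permutations of the `2k` elements that respect the partition into pairs. -/
abbrev PairPerm (k : ℕ) : Type :=
  {π : Equiv.Perm (Fin k × ZMod 2) // ∀ p q, (π p).1 = (π q).1 ↔ p.1 = q.1}

/-- Two adapted enumerations differ by a permutation of the index set preserving the pairing, so
their number does not depend on the structure. This is the multiplicity in the double count. -/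
theorem Adapted.card_adapted {e₀ : Fin k × ZMod 2 ↪ V} {X : Set (Atom ar V)}
    (h₀ : Adapted e₀ X) : Nat.card {e : Fin k × ZMod 2 ↪ V // Adapted e X} = Nat.card (PairPerm k) := by
  symm
  refine Nat.card_congr (Equiv.ofBijective
    (fun π => ⟨π.1.toEmbedding.trans e₀, ?_, fun p q => ?_⟩) ⟨?_, ?_⟩)
  · rw [← h₀.1]
    exact π.1.surjective.range_comp e₀
  · exact (h₀.2 _ _).trans (π.2 p q)
  · intro π σ h
    ext1
    ext1 p
    have := congrArg (fun e : {e : Fin k × ZMod 2 ↪ V // Adapted e X} => e.1 p) h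
    exact e₀.injective this
  · rintro ⟨e, he⟩
    let π : Equiv.Perm (Fin k × ZMod 2) :=
      (Equiv.ofInjective e e.injective).trans ((Equiv.setCongr (he.1.trans h₀.1.symm)).trans
        (Equiv.ofInjective e₀ e₀.injective).symm)
    have hπ : ∀ p, e₀ (π p) = e p := fun p =>
      congrArg Subtype.val ((Equiv.ofInjective e₀ e₀.injective).apply_symm_apply _)
    refine ⟨⟨π, fun p q => ?_⟩, Subtype.ext (DFunLike.ext _ _ hπ)⟩
    rw [← h₀.2, ← he.2, hπ, hπ]

theorem card_pairPerm_pos : 0 < Nat.card (PairPerm k) :=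
  Nat.card_pos_iff.2 ⟨⟨⟨1, fun _ _ => Iff.rfl⟩⟩, inferInstance⟩

theorem card_support_viaEmbedding_pairFlip [Fintype V] [DecidableEq V] (e : Fin k × ZMod 2 ↪ V)
    (v : Fin k → ZMod 2) :
    ((pairFlip v).viaEmbedding e).support.card = 2 * (Finset.univ.filter fun j => v j ≠ 0).card := by
  have : ((pairFlip v).viaEmbedding e).support =
      ((Finset.univ.filter fun j => v j ≠ 0) ×ˢ (Finset.univ : Finset (ZMod 2))).map e := by
    ext a
    rw [Equiv.Perm.mem_support, Finset.mem_map]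
    by_cases ha : a ∈ Set.range e
    · obtain ⟨p, rfl⟩ := ha
      rw [Equiv.Perm.viaEmbedding_apply, e.injective.ne_iff]
      simp only [e.injective.eq_iff, exists_eq_right, pairFlip_apply, Finset.mem_product,
        Finset.mem_filter, Finset.mem_univ, true_and, and_true]
      rw [ne_eq, Prod.ext_iff]
      simp
    · rw [Equiv.Perm.viaEmbedding_apply_of_notMem _ _ _ ha]
      simp only [ne_eq, not_true_eq_false, false_iff]
      rintro ⟨p, -, rfl⟩
      exact ha ⟨p, rfl⟩
  rw [this, Finset.card_map, Finset.card_product, mul_comm]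
  simp

/-- A flip moves twice as many elements as its vector has nonzero entries. As m ≥ 2k-1, moving m
elements forces all k entries to be nonzero. -/
theorem Adapted.exists_le_card_support_iff [Fintype V] [DecidableEq V] (har : ∀ r, ar r ≤ 2)
    {e : Fin k × ZMod 2 ↪ V} {X : Set (Atom ar V)} (h : Adapted e X) {m : ℕ} (hm : m ≤ 2 * k)
    (hm' : 2 * k ≤ m + 1) :
    (∃ f ∈ aut X, m ≤ f.support.card) ↔ 1 ∈ flipSubmodule (Atom.map e ⁻¹' X) := by
  constructor
  · rintro ⟨f, hf, hmf⟩
    obtain ⟨v, hv, rfl⟩ := h.exists_pairFlip hf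
    rw [card_support_viaEmbedding_pairFlip] at hmf
    have hle := Finset.card_le_univ (Finset.univ.filter fun j => v j ≠ 0)
    rw [Fintype.card_fin] at hle
    have hk : (Finset.univ.filter fun j => v j ≠ 0).card = Fintype.card (Fin k) := by
      rw [Fintype.card_fin]
      omega
    rw [Finset.card_eq_iff_eq_univ, Finset.filter_eq_self] at hk
    have : v = 1 := by
      ext1 j
      have h1 : ∀ x : ZMod 2, x ≠ 0 → x = 1 := by decide
      exact h1 _ (hk j (Finset.mem_univ _))
    rwa [← this]
  · intro h1
    refine ⟨_, viaEmbedding_mem_aut (h.mem_frame har) h1, ?_⟩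
    rw [card_support_viaEmbedding_pairFlip]
    simpa using hm

end Adapted

/-! ### Elementary counting: unions, equivalence classes, invariant sets. -/

section Union
variable {E α : Type*}

theorem card_subtype_mono [Finite α] {P Q : α → Prop} (h : ∀ x, P x → Q x) :
    Nat.card {x // P x} ≤ Nat.card {x // Q x} :=
  Nat.card_le_card_of_injective (fun x => ⟨x.1, h _ x.2⟩)
    fun _ _ hxy => Subtype.ext (congrArg (fun z : {x // Q x} => z.1) hxy)

theorem card_or_le [Finite α] (P Q : α → Prop) :
    Nat.card {x // P x ∨ Q x} ≤ Nat.card {x // P x} + Nat.card {x // Q x} := by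
  classical
  rw [← Nat.card_sum]
  exact Nat.card_le_card_of_injective _ (subtypeOrLeftEmbedding P Q).injective

theorem card_exists_le_sum [Fintype E] [Finite α] (P : E → α → Prop) :
    Nat.card {x // ∃ e, P e x} ≤ ∑ e, Nat.card {x // P e x} := by
  rw [← Nat.card_sigma]
  refine Nat.card_le_card_of_surjective
    (fun y : Σ e, {x // P e x} => (⟨y.2.1, y.1, y.2.2⟩ : {x // ∃ e, P e x})) ?_
  rintro ⟨x, e, he⟩
  exact ⟨⟨e, x, he⟩, rfl⟩

theorem card_exists_le_mul [Finite E] [Finite α] (P : E → α → Prop) {C : ℕ}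
    (h : ∀ e, Nat.card {x // P e x} ≤ C) :
    Nat.card {x // ∃ e, P e x} ≤ Nat.card E * C := by
  have := Fintype.ofFinite E
  refine (card_exists_le_sum P).trans ((Finset.sum_le_sum fun e _ => h e).trans ?_)
  simp

theorem card_pairs [Fintype E] [Finite α] (P : E → α → Prop) :
    Nat.card {p : E × α // P p.1 p.2} = ∑ e, Nat.card {x // P e x} := by
  rw [← Nat.card_sigma]
  exact Nat.card_congr
    { toFun := fun p => ⟨p.1.1, p.1.2, p.2⟩
      invFun := fun y => ⟨(y.1, y.2.1), y.2.2⟩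
      left_inv := fun _ => rfl
      right_inv := fun _ => rfl }

end Union

section Classes
variable {α : Type*} [Finite α]

theorem sum_card_fiber (r : Setoid α) [Fintype (Quotient r)] :
    ∑ q : Quotient r, Nat.card {a // (Quotient.mk r a) = q} = Nat.card α := by
  rw [← Nat.card_sigma]
  exact Nat.card_congr (Equiv.sigmaFiberEquiv _)

theorem two_le_card_fiber (r : Setoid α) (h : ∀ a, ∃ b, b ≠ a ∧ r a b) (q : Quotient r) :
    2 ≤ Nat.card {a // (Quotient.mk r a) = q} := by
  induction q using Quotient.inductionOn with
  | h a =>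
    obtain ⟨b, hb, hab⟩ := h a
    rw [Nat.succ_le_iff, Finite.one_lt_card_iff_nontrivial]
    exact ⟨⟨a, rfl⟩, ⟨b, (Quotient.sound hab).symm⟩, fun h' => hb (congrArg Subtype.val h').symm⟩

theorem two_mul_card_quotient_le (r : Setoid α) (h : ∀ a, ∃ b, b ≠ a ∧ r a b) :
    2 * Nat.card (Quotient r) ≤ Nat.card α := by
  have := Fintype.ofFinite (Quotient r)
  rw [← sum_card_fiber r, Nat.card_eq_fintype_card, mul_comm]
  simpa using Finset.sum_le_sum fun q (_ : q ∈ Finset.univ) => two_le_card_fiber r h q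

/-- If all classes have at least two elements and there are `k` classes on `2k` elements, then
the set can be enumerated by pairs, the pairs being the classes. -/
theorem exists_pair_equiv (r : Setoid α) (h : ∀ a, ∃ b, b ≠ a ∧ r a b) {k : ℕ}
    (hk : Nat.card (Quotient r) = k) (hα : Nat.card α = 2 * k) :
    ∃ e : Fin k × ZMod 2 ≃ α, ∀ p q, r (e p) (e q) ↔ p.1 = q.1 := by
  have := Fintype.ofFinite (Quotient r)
  have h2 : ∀ q : Quotient r, 2 = Nat.card {a // (Quotient.mk r a) = q} := by
    have := (Finset.sum_eq_sum_iff_of_le fun q (_ : q ∈ Finset.univ) =>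
      -- Each of the k classes has at least 2 elements and the sizes add up to 2k, so all these
      -- bounds are equalities.
      two_le_card_fiber r h q).1 (by
        rw [sum_card_fiber, hα, ← hk, Nat.card_eq_fintype_card]
        simp [mul_comm])
    exact fun q => this q (Finset.mem_univ _)
  have e1 : ∀ q : Quotient r, Nonempty (ZMod 2 ≃ {a // (Quotient.mk r a) = q}) := fun q =>
    Finite.card_eq.1 (by rw [← h2 q]; simp)
  replace e1 := fun q => (e1 q).some
  obtain ⟨e2⟩ : Nonempty (Fin k ≃ Quotient r) :=
    Finite.card_eq.1 (by rw [hk, Nat.card_fin])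
  refine ⟨(e2.prodCongr (Equiv.refl _)).trans ((Equiv.sigmaEquivProd _ _).symm.trans
    ((Equiv.sigmaCongrRight e1).trans (Equiv.sigmaFiberEquiv _))), fun p q => ?_⟩
  rw [← Quotient.eq]
  change Quotient.mk r (e1 (e2 p.1) p.2).1 = Quotient.mk r (e1 (e2 q.1) q.2).1 ↔ _
  rw [(e1 (e2 p.1) p.2).2, (e1 (e2 q.1) q.2).2, e2.injective.eq_iff]

open scoped Pointwise in
/-- A permutation `g` has at most `2 ^ ((|α| + |Fix g|) / 2)` invariant sets. -/
theorem sq_card_invariant_le (g : Equiv.Perm α) :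
    Nat.card {X : Set α // ∀ a, g a ∈ X ↔ a ∈ X} ^ 2 ≤
      2 ^ (Nat.card α + Nat.card {a // g a = a}) := by
  let r := Equiv.Perm.SameCycle.setoid g
  have := Fintype.ofFinite (Quotient r)
  have hinv : ∀ X : Set α, (∀ a, g a ∈ X ↔ a ∈ X) → ∀ a b, r a b → (a ∈ X ↔ b ∈ X) := by
    rintro X hX a b ⟨i, rfl⟩
    have hX' : g ∈ (MulAction.stabilizer (Equiv.Perm α) X) := by
      rw [MulAction.mem_stabilizer_set]
      exact hX
    exact ((MulAction.mem_stabilizer_set.1 (zpow_mem hX' i)) a).symm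
  have h1 : Nat.card {X : Set α // ∀ a, g a ∈ X ↔ a ∈ X} ≤ 2 ^ Nat.card (Quotient r) := by
    rw [← card_set_eq]
    refine Nat.card_le_card_of_injective (fun X => Quotient.mk r '' X.1) ?_
    rintro ⟨X, hX⟩ ⟨Y, hY⟩ h
    have key : ∀ Z : Set α, (∀ a, g a ∈ Z ↔ a ∈ Z) →
        ∀ a, Quotient.mk r a ∈ Quotient.mk r '' Z ↔ a ∈ Z := by
      refine fun Z hZ a => ⟨?_, fun ha => ⟨a, ha, rfl⟩⟩
      rintro ⟨b, hb, hba⟩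
      exact (hinv Z hZ b a (Quotient.exact hba)).1 hb
    ext a
    exact (key X hX a).symm.trans ((iff_of_eq (congrArg (Quotient.mk r a ∈ ·) h)).trans (key Y hY a))
  have h2 : 2 * Nat.card (Quotient r) ≤ Nat.card α + Nat.card {a // g a = a} := by
    have hf : ∑ q : Quotient r, Nat.card {a : {a // g a = a} // (Quotient.mk r a.1) = q} =
        Nat.card {a // g a = a} := by
      rw [← Nat.card_sigma]
      exact Nat.card_congr (Equiv.sigmaFiberEquiv _)
    rw [← sum_card_fiber r, ← hf, ← Finset.sum_add_distrib, Nat.card_eq_fintype_card, mul_comm]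
    -- A fixed point is a singleton cycle counted in both summands; any other cycle has two elements
    -- already.
    have : ∀ q : Quotient r, 2 ≤ Nat.card {a // (Quotient.mk r a) = q} +
        Nat.card {a : {a // g a = a} // (Quotient.mk r a.1) = q} := by
      intro q
      induction q using Quotient.inductionOn with
      | h a =>
        by_cases ha : g a = a
        · have h1 : 0 < Nat.card {b // (Quotient.mk r b) = Quotient.mk r a} :=
            Nat.card_pos_iff.2 ⟨⟨⟨a, rfl⟩⟩, inferInstance⟩
          have h2 : 0 < Nat.card {b : {a // g a = a} // (Quotient.mk r b.1) = Quotient.mk r a} :=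
            Nat.card_pos_iff.2 ⟨⟨⟨⟨a, ha⟩, rfl⟩⟩, inferInstance⟩
          omega
        · have hag : r a (g a) := Equiv.Perm.sameCycle_apply_right.2 (Equiv.Perm.SameCycle.refl g a)
          refine le_add_right ?_
          rw [Nat.succ_le_iff, Finite.one_lt_card_iff_nontrivial]
          exact ⟨⟨a, rfl⟩, ⟨g a, (Quotient.sound hag).symm⟩,
            fun h' => ha (congrArg Subtype.val h').symm⟩
    simpa using Finset.sum_le_sum fun q (_ : q ∈ Finset.univ) => this q
  calc _ ≤ (2 ^ Nat.card (Quotient r)) ^ 2 := Nat.pow_le_pow_left h1 2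
    _ = 2 ^ (2 * Nat.card (Quotient r)) := by rw [← pow_mul, mul_comm]
    _ ≤ _ := Nat.pow_le_pow_right two_pos h2

end Classes

/-! ### Supports of automorphisms. -/

section Support
variable {R : Type*} {ar : R → ℕ} {V : Type*} [Fintype V] [DecidableEq V]

/-- An averaging argument: if every automorphism moves at most `T` elements, then at most `2T`
elements are moved altogether. -/
theorem ncard_moved_le (X : Set (Atom ar V)) {T : ℕ}
    (h : ∀ f ∈ aut X, f.support.card ≤ T) : (moved X).ncard ≤ 2 * T := by
  classical
  have hG : 0 < Fintype.card (aut X) := Fintype.card_pos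
  have h1 : ∑ f : aut X, f.1.support.card =
      ∑ a : V, (Finset.univ.filter fun f : aut X => f.1 a ≠ a).card := by
    have : ∀ f : aut X, f.1.support = Finset.univ.filter fun a => f.1 a ≠ a := fun f => by
      ext a
      simp
    simp only [this, Finset.card_filter]
    exact Finset.sum_comm
  -- If `g` moves `a`, left multiplication by `g` injects the stabiliser of `a` into its complement,
  -- so at least half of the group moves `a`.
  have h2 : ∀ a ∈ moved X, Fintype.card (aut X) ≤
      2 * (Finset.univ.filter fun f : aut X => f.1 a ≠ a).card := by
    rintro a ⟨g, hg, hga⟩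
    have h3 := Finset.card_filter_add_card_filter_not (s := (Finset.univ : Finset (aut X)))
      (fun f : aut X => f.1 a = a)
    have h4 : (Finset.univ.filter fun f : aut X => f.1 a = a).card ≤
        (Finset.univ.filter fun f : aut X => f.1 a ≠ a).card := by
      refine Finset.card_le_card_of_injOn (fun f => ⟨g, hg⟩ * f) (fun f hf => ?_)
        (mul_right_injective _).injOn
      have hfa : f.1 a = a := by simpa using hf
      simp [hfa, hga]
    rw [Finset.card_univ] at h3
    change _ + (Finset.univ.filter fun f : aut X => f.1 a ≠ a).card = _ at h3
    omega
  have h5 : (moved X).ncard * Fintype.card (aut X) ≤ 2 * ∑ f : aut X, f.1.support.card := by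
    rw [h1, Finset.mul_sum, Set.ncard_eq_toFinset_card', ← smul_eq_mul, ← Finset.sum_const]
    exact (Finset.sum_le_sum fun a ha => h2 a (Set.mem_toFinset.1 ha)).trans
      (Finset.sum_le_sum_of_subset (Finset.subset_univ _))
  have h6 : ∑ f : aut X, f.1.support.card ≤ Fintype.card (aut X) * T := by
    simpa using Finset.sum_le_sum fun (f : aut X) (_ : f ∈ Finset.univ) => h f.1 f.2
  refine Nat.le_of_mul_le_mul_right (h5.trans ?_) hG
  calc _ ≤ 2 * (Fintype.card (aut X) * T) := Nat.mul_le_mul_left _ h6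
    _ = _ := by ring

/-- A permutation is determined by a list of its t moved elements together with their images. -/
theorem card_perm_support_le (t : ℕ) :
    Nat.card {f : Equiv.Perm V // f.support.card = t} ≤ Nat.card V ^ (2 * t) := by
  have : Nat.card ((Fin t → V) × (Fin t → V)) = Nat.card V ^ (2 * t) := by
    rw [Nat.card_prod, Nat.card_fun, Nat.card_fin, ← pow_add, two_mul]
  rw [← this]
  let en : ∀ f : {f : Equiv.Perm V // f.support.card = t}, Fin t → V := fun f i =>
    ((Finset.equivFinOfCardEq f.2).symm i).1
  have hen : ∀ f, ∀ a, a ∈ f.1.support ↔ ∃ i, en f i = a := fun f a =>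
    ⟨fun ha => ⟨Finset.equivFinOfCardEq f.2 ⟨a, ha⟩, by simp [en]⟩,
      by rintro ⟨i, rfl⟩; exact ((Finset.equivFinOfCardEq f.2).symm i).2⟩
  refine Nat.card_le_card_of_injective (fun f => (en f, f.1 ∘ en f)) ?_
  intro f g h
  simp only [Prod.mk.injEq] at h
  ext a
  by_cases ha : a ∈ f.1.support
  · obtain ⟨i, rfl⟩ := (hen f a).1 ha
    have := congrFun h.2 i
    rw [Function.comp_apply, Function.comp_apply, ← h.1] at this
    exact this
  · have hg : a ∉ g.1.support := by rwa [hen, ← h.1, ← hen]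
    rw [Equiv.Perm.notMem_support.1 ha, Equiv.Perm.notMem_support.1 hg]

/-- Apply `sq_card_invariant_le` to the permutation that `f` induces on atoms; its fixed atoms are
those over the unmoved elements. -/
theorem sq_card_aut_le [Fintype R] (f : Equiv.Perm V) :
    Nat.card {X : Set (Atom ar V) // f ∈ aut X} ^ 2 ≤
      2 ^ (numAtoms ar (Nat.card V) + numAtoms ar (Nat.card V - f.support.card)) := by
  let g : Equiv.Perm (Atom ar V) := Equiv.ofBijective (Atom.map f)
    ⟨Atom.map_injective f.injective, Atom.map_surjective f.surjective⟩
  have hfix : Nat.card {a : Atom ar V // g a = a} =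
      numAtoms ar (Nat.card V - f.support.card) := by
    have hc : Nat.card {v // f v = v} = Nat.card V - f.support.card := by
      have h1 : Nat.card {v // f v = v} = (f.support : Set V)ᶜ.ncard := by
        change Nat.card {v | f v = v} = _
        rw [Nat.card_coe_set_eq]
        congr 1
        ext v
        simp
      rw [h1, Set.ncard_compl, Set.ncard_coe_finset]
    rw [← hc, ← card_atom]
    symm
    refine Nat.card_congr (Equiv.ofBijective
      (fun b => ⟨b.map Subtype.val, ?_⟩) ⟨?_, ?_⟩)
    · exact Atom.map_eq_self_iff.2 fun i => (b.2 i).2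
    · intro b c h
      exact Atom.map_injective Subtype.val_injective (congrArg Subtype.val h)
    · rintro ⟨a, ha⟩
      have ha' : a.LiesIn (Set.range (Subtype.val : {v // f v = v} → V)) := fun i =>
        ⟨⟨_, Atom.map_eq_self_iff.1 ha i⟩, rfl⟩
      obtain ⟨b, hb⟩ := Atom.liesIn_range_iff.1 ha'
      exact ⟨b, Subtype.ext hb⟩
  have := sq_card_invariant_le g
  rwa [hfix, card_atom] at this

end Support

/-! ### Structures of the wrong orbit shape. -/

section Exceptional
variable {R : Type*} {ar : R → ℕ} {V : Type*}

/-- At least `m` elements are moved, but not because the orbits of moved elements form `k` pairs. -/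
def Exceptional (k m : ℕ) (X : Set (Atom ar V)) : Prop :=
  m ≤ (moved X).ncard ∧ ∀ e : Fin k × ZMod 2 ↪ V, ¬ Adapted e X

/-- Some automorphism moves many elements. -/
def LargeSupport [Fintype V] [DecidableEq V] (k : ℕ) (X : Set (Atom ar V)) : Prop :=
  ∃ f ∈ aut X, 8 * k < f.support.card

/-- Possible maps from moved elements to orbit representatives, other than for `k` pairs. -/
abbrev OrbitPattern (k : ℕ) : Type :=
  {j : Σ s : Fin (16 * k + 1), (Fin s → Fin s) // 2 * k ≤ j.1.1 + 1 ∧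
    2 * Nat.card (Set.range j.2) ≤ j.1.1 ∧ ¬ (j.1.1 = 2 * k ∧ Nat.card (Set.range j.2) = k)}

/-- Few elements are moved, and the structure is in a frame of some exceptional pattern. -/
def SmallExceptional (k : ℕ) (X : Set (Atom ar V)) : Prop :=
  (moved X).ncard ≤ 16 * k ∧ ∃ j : OrbitPattern k, ∃ e : Fin j.1.1 ↪ V, X ∈ Frame ar e j.1.2

/-- Without large support, averaging bounds the moved set by 16k. Sending each moved element to an
orbit representative then gives the pattern; its orbits have size at least 2, and k orbits on 2k
elements would give an adapted enumeration. -/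
theorem Exceptional.large_or_small [Fintype V] [DecidableEq V] (har : ∀ r, ar r ≤ 2) {k m : ℕ}
    (hm : 2 * k ≤ m + 1) {X : Set (Atom ar V)} (h : Exceptional k m X) :
    LargeSupport k X ∨ SmallExceptional k X := by
  by_cases hl : LargeSupport k X
  · exact Or.inl hl
  right
  have hs : (moved X).ncard ≤ 16 * k := by
    have : ∀ f ∈ aut X, f.support.card ≤ 8 * k := fun f hf => by
      by_contra hc
      exact hl ⟨f, hf, not_le.1 hc⟩
    have := ncard_moved_le X this
    omega
  refine ⟨hs, ?_⟩
  obtain ⟨e0⟩ : Nonempty (Fin (moved X).ncard ≃ moved X) :=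
    Finite.card_eq.1 (by rw [Nat.card_fin, Nat.card_coe_set_eq])
  let e : Fin (moved X).ncard ↪ V := e0.toEmbedding.trans (Function.Embedding.subtype _)
  have he : Set.range e = moved X := by
    change Set.range (Subtype.val ∘ e0) = _
    rw [e0.surjective.range_comp, Subtype.range_coe]
  let r : Setoid (Fin (moved X).ncard) :=
    { r := fun p q => ∃ f ∈ aut X, f (e p) = e q
      iseqv := ⟨fun p => ⟨1, one_mem _, rfl⟩,
        fun {p q} ⟨f, hf, hpq⟩ => ⟨f⁻¹, inv_mem hf, by rw [← hpq]; simp⟩,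
        fun {p q s} ⟨f, hf, hpq⟩ ⟨g, hg, hqs⟩ => ⟨g * f, mul_mem hg hf, by simp [hpq, hqs]⟩⟩ }
  have hr : ∀ a, ∃ b, b ≠ a ∧ r a b := by
    intro a
    obtain ⟨f, hf, hfa⟩ : e a ∈ moved X := he.subset ⟨a, rfl⟩
    have : f (e a) ∈ moved X := ⟨f, hf, fun h' => hfa (f.injective h')⟩
    obtain ⟨b, hb⟩ := he.superset this
    refine ⟨b, ?_, f, hf, hb.symm⟩
    rintro rfl
    exact hfa hb.symm
  have hρ : Nat.card (Set.range fun p => (Quotient.mk r p).out) = Nat.card (Quotient r) := by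
    have : (Set.range fun p => (Quotient.mk r p).out) = Set.range (Quotient.out (s := r)) :=
      Quotient.mk_surjective.range_comp (Quotient.out (s := r))
    rw [this]
    exact (Nat.card_congr (Equiv.ofInjective _ (Quotient.out_injective (s := r)))).symm
  refine ⟨⟨⟨⟨_, Nat.lt_succ_of_le hs⟩, fun p => (Quotient.mk r p).out⟩, ?_, ?_, ?_⟩, e, ?_⟩
  · have := h.1
    dsimp only
    omega
  · dsimp only
    rw [hρ]
    simpa using two_mul_card_quotient_le r hr
  · dsimp only
    rw [hρ]
    rintro ⟨h1, h2⟩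
    obtain ⟨e', he'⟩ := exists_pair_equiv r hr h2 (by rw [Nat.card_fin, h1])
    refine h.2 (e'.toEmbedding.trans e) ⟨?_, he'⟩
    exact (e'.surjective.range_comp e).trans he
  · exact mem_frame_of_orbit har e _ he fun p => r.symm (Quotient.mk_out p)

end Exceptional

/-! ### Exceptional structures are negligible. -/

section Bounds
variable {R : Type*} [Fintype R] {ar : R → ℕ}

/-- For a binary symbol this is 2(n² + (n-t)²) + tn ≤ 4(n-k)², which follows from t ≤ n and 8k ≤ t.
The surplus tn pays for the choice of a permutation with support t. -/
theorem numAtoms_large (har : ∀ r, ar r ≤ 2) (h2 : ∃ r, ar r = 2) {n k t : ℕ} (ht : 8 * k ≤ t)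
    (htn : t ≤ n) :
    2 * (numAtoms ar n + numAtoms ar (n - t)) + t * n ≤ 4 * numAtoms ar (n - k) := by
  obtain ⟨r₀, hr₀⟩ := h2
  have h1 : t * n ≤ ∑ r, if ar r = 2 then t * n else 0 := by
    have := Finset.single_le_sum (f := fun r => if ar r = 2 then t * n else 0)
      (fun r _ => Nat.zero_le _) (Finset.mem_univ r₀)
    simpa [hr₀] using this
  have h3 : ∀ r, 2 * (n ^ ar r + (n - t) ^ ar r) + (if ar r = 2 then t * n else 0) ≤
      4 * (n - k) ^ ar r := by
    intro r
    have hr : ar r = 0 ∨ ar r = 1 ∨ ar r = 2 := by have := har r; omega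
    rcases hr with hr | hr | hr
    · simp [hr]
    · simp only [hr, pow_one]
      simp only [OfNat.one_ne_ofNat, if_false]
      omega
    · simp only [hr, if_true]
      obtain ⟨d, rfl⟩ := Nat.exists_eq_add_of_le htn
      obtain ⟨c, rfl⟩ := Nat.exists_eq_add_of_le ht
      have e1 : 8 * k + c + d - (8 * k + c) = d := by omega
      have e2 : 8 * k + c + d - k = 7 * k + c + d := by omega
      rw [e1, e2]
      nlinarith [Nat.zero_le (k * k), Nat.zero_le (k * c), Nat.zero_le (k * d),
        Nat.zero_le (c * d), Nat.zero_le (c * c)]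
  have h4 := Finset.sum_le_sum fun r (_ : r ∈ Finset.univ) => h3 r
  rw [Finset.sum_add_distrib, ← Finset.mul_sum, ← Finset.mul_sum, Finset.sum_add_distrib] at h4
  unfold numAtoms
  omega

/-- Removing one more element loses a number of binary atoms linear in n, hence a factor 2^n in the
count of structures. -/
theorem numAtoms_gap (h2 : ∃ r, ar r = 2) {n k d : ℕ} (hd : k + 1 ≤ d) (hn : 2 * k + 1 ≤ n) :
    numAtoms ar (n - d) + n ≤ numAtoms ar (n - k) := by
  obtain ⟨r₀, hr₀⟩ := h2
  have h1 : n ≤ ∑ r, if ar r = 2 then n else 0 := by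
    have := Finset.single_le_sum (f := fun r => if ar r = 2 then n else 0)
      (fun r _ => Nat.zero_le _) (Finset.mem_univ r₀)
    simpa [hr₀] using this
  have h3 : ∀ r, (n - d) ^ ar r + (if ar r = 2 then n else 0) ≤ (n - k) ^ ar r := by
    intro r
    split_ifs with hr
    · rw [hr]
      obtain ⟨c, rfl⟩ := Nat.exists_eq_add_of_le hn
      have h5 : 2 * k + 1 + c - d ≤ k + c := by omega
      have h6 : 2 * k + 1 + c - k = k + 1 + c := by omega
      rw [h6]
      nlinarith [Nat.pow_le_pow_left h5 2]
    · exact Nat.pow_le_pow_left (by omega) _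
  have h4 := Finset.sum_le_sum fun r (_ : r ∈ Finset.univ) => h3 r
  rw [Finset.sum_add_distrib] at h4
  unfold numAtoms
  omega

/-- `n ^ (2k) * 2 ^ (number of atoms on n - k elements)`, the order of magnitude of the number of
structures with at least `2k - 1` moved elements. -/
noncomputable def scale (ar : R → ℕ) (k n : ℕ) : ℝ := (n : ℝ) ^ (2 * k) * 2 ^ numAtoms ar (n - k)

theorem card_aut_le (har : ∀ r, ar r ≤ 2) (h2 : ∃ r, ar r = 2) {β : ℝ} (hβ0 : 0 < β)
    (hβ : β ^ 4 = 1 / 2) {n k : ℕ} (f : Equiv.Perm (Fin n)) (hf : 8 * k ≤ f.support.card) :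
    (Nat.card {X : Set (Atom ar (Fin n)) // f ∈ aut X} : ℝ) ≤
      2 ^ numAtoms ar (n - k) * β ^ (f.support.card * n) := by
  set t := f.support.card
  have htn : t ≤ n := by simpa using f.support.card_le_univ
  have h1 := sq_card_aut_le (ar := ar) f
  rw [Nat.card_fin] at h1
  have h3 := numAtoms_large har h2 hf htn
  refine le_of_pow_le_pow_left₀ (n := 4) (by norm_num) (by positivity) ?_
  -- The fourth power clears two halvings: the square root in `sq_card_aut_le` and the factor 2 in
  -- `numAtoms_large`.
  have h4 : Nat.card {X : Set (Atom ar (Fin n)) // f ∈ aut X} ^ 4 * 2 ^ (t * n) ≤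
      2 ^ (4 * numAtoms ar (n - k)) := by
    calc _ = (Nat.card {X : Set (Atom ar (Fin n)) // f ∈ aut X} ^ 2) ^ 2 * 2 ^ (t * n) := by
          rw [← pow_mul]
      _ ≤ (2 ^ (numAtoms ar n + numAtoms ar (n - t))) ^ 2 * 2 ^ (t * n) :=
          Nat.mul_le_mul_right _ (Nat.pow_le_pow_left h1 2)
      _ = 2 ^ (2 * (numAtoms ar n + numAtoms ar (n - t)) + t * n) := by
          rw [← pow_mul, ← pow_add, mul_comm 2]
      _ ≤ _ := Nat.pow_le_pow_right two_pos h3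
  have h5 : (Nat.card {X : Set (Atom ar (Fin n)) // f ∈ aut X} : ℝ) ^ 4 * 2 ^ (t * n) ≤
      2 ^ (4 * numAtoms ar (n - k)) := by exact_mod_cast h4
  rw [mul_pow, ← pow_mul, ← pow_mul, mul_comm (t * n) 4, pow_mul β, hβ, one_div, inv_pow,
    ← div_eq_mul_inv, le_div_iff₀ (by positivity), mul_comm (numAtoms _ _)]
  exact h5

/-- Union bound over the support size t. There are at most n^(2t) permutations and n^(2k) ≤ n^t, so
each t contributes at most (n³βⁿ)^t times 2^N(n-k), and the base is at most 1. Discarding t = 0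
leaves n terms, whence n⁴. -/
theorem card_largeSupport_le (har : ∀ r, ar r ≤ 2) (h2 : ∃ r, ar r = 2) {β : ℝ} (hβ0 : 0 < β)
    (hβ : β ^ 4 = 1 / 2) {n k : ℕ} (hk : 0 < k) (hn : 1 ≤ n) (hsmall : (n : ℝ) ^ 3 * β ^ n ≤ 1) :
    (n : ℝ) ^ (2 * k) * Nat.card {X : Set (Atom ar (Fin n)) // LargeSupport k X} ≤
      (n : ℝ) ^ 4 * β ^ n * 2 ^ numAtoms ar (n - k) := by
  have hn' : (1 : ℝ) ≤ n := by exact_mod_cast hn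
  have hcard : ∀ t : Fin (n + 1), (n : ℝ) ^ (2 * k) *
      Nat.card {X : Set (Atom ar (Fin n)) //
        ∃ f : {f : Equiv.Perm (Fin n) // f.support.card = t.1}, 8 * k < t.1 ∧ f.1 ∈ aut X} ≤
      if t.1 = 0 then 0 else (n : ℝ) ^ 3 * β ^ n * 2 ^ numAtoms ar (n - k) := by
    intro t
    by_cases ht : 8 * k < t.1
    · rw [if_neg (by omega)]
      have hle : ∀ f : {f : Equiv.Perm (Fin n) // f.support.card = t.1},
          Nat.card {X : Set (Atom ar (Fin n)) // 8 * k < t.1 ∧ f.1 ∈ aut X} ≤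
            ⌊(2 : ℝ) ^ numAtoms ar (n - k) * β ^ (t.1 * n)⌋₊ := by
        intro f
        refine Nat.le_floor ?_
        have := card_aut_le har h2 hβ0 hβ (k := k) f.1 (by rw [f.2]; omega)
        rw [f.2] at this
        refine le_trans ?_ this
        exact Nat.cast_le.2 (card_subtype_mono fun _ (hX : _ ∧ _) => hX.2)
      have h3 := card_exists_le_mul _ hle
      have h4 := (h3.trans (Nat.mul_le_mul_right _ (card_perm_support_le t.1)))
      rw [Nat.card_fin] at h4
      have h5 : (Nat.card {X : Set (Atom ar (Fin n)) //
          ∃ f : {f : Equiv.Perm (Fin n) // f.support.card = t.1}, 8 * k < t.1 ∧ f.1 ∈ aut X} : ℝ) ≤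
          (n : ℝ) ^ (2 * t.1) * (2 ^ numAtoms ar (n - k) * β ^ (t.1 * n)) := by
        refine (Nat.cast_le.2 h4).trans ?_
        push_cast
        gcongr
        exact Nat.floor_le (by positivity)
      calc _ ≤ (n : ℝ) ^ t.1 * ((n : ℝ) ^ (2 * t.1) *
            (2 ^ numAtoms ar (n - k) * β ^ (t.1 * n))) := by
            gcongr
            omega
        _ = ((n : ℝ) ^ 3 * β ^ n) ^ t.1 * 2 ^ numAtoms ar (n - k) := by
            rw [mul_pow, ← pow_mul, ← pow_mul, mul_comm n, show 3 * t.1 = t.1 + 2 * t.1 by ring,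
              pow_add]
            ring
        _ ≤ _ := by
            gcongr
            exact pow_le_of_le_one (by positivity) hsmall (by omega)
    · have : Nat.card {X : Set (Atom ar (Fin n)) //
          ∃ f : {f : Equiv.Perm (Fin n) // f.support.card = t.1}, 8 * k < t.1 ∧ f.1 ∈ aut X} = 0 := by
        rw [Nat.card_eq_zero]
        left
        exact ⟨fun X => by obtain ⟨f, hf, -⟩ := X.2; exact ht hf⟩
      rw [this]
      simp only [Nat.cast_zero, mul_zero]
      split_ifs
      · rfl
      · positivity
  have hsub : Nat.card {X : Set (Atom ar (Fin n)) // LargeSupport k X} ≤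
      ∑ t : Fin (n + 1), Nat.card {X : Set (Atom ar (Fin n)) //
        ∃ f : {f : Equiv.Perm (Fin n) // f.support.card = t.1}, 8 * k < t.1 ∧ f.1 ∈ aut X} := by
    refine le_trans (card_subtype_mono ?_) (card_exists_le_sum _)
    rintro X ⟨f, hf, hkf⟩
    have htn : f.support.card ≤ n := by simpa using f.support.card_le_univ
    exact ⟨⟨_, Nat.lt_succ_of_le htn⟩, ⟨f, rfl⟩, hkf, hf⟩
  calc _ ≤ (n : ℝ) ^ (2 * k) * ((∑ t : Fin (n + 1), Nat.card {X : Set (Atom ar (Fin n)) //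
        ∃ f : {f : Equiv.Perm (Fin n) // f.support.card = t.1}, 8 * k < t.1 ∧ f.1 ∈ aut X} : ℕ) : ℝ) := by
        gcongr
    _ ≤ ∑ t : Fin (n + 1), if t.1 = 0 then (0 : ℝ) else
        (n : ℝ) ^ 3 * β ^ n * 2 ^ numAtoms ar (n - k) := by
        push_cast
        rw [Finset.mul_sum]
        exact Finset.sum_le_sum fun t _ => hcard t
    _ = _ := by
        rw [Fin.sum_univ_succ]
        simp
        ring

theorem card_frame_pattern_le (h2 : ∃ r, ar r = 2) {n k : ℕ} (hn : 2 * k + 1 ≤ n)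
    (j : OrbitPattern k) :
    (Nat.card {X : Set (Atom ar (Fin n)) // ∃ e : Fin j.1.1 ↪ Fin n, X ∈ Frame ar e j.1.2} : ℝ) ≤
      2 ^ numAtoms ar (16 * k) * ((1 / n : ℝ) + (n : ℝ) ^ (16 * k) * (1 / 2) ^ n) *
        scale ar k n := by
  obtain ⟨⟨⟨s, hs⟩, ρ⟩, h3, h4, h5⟩ := j
  simp only at h3 h4 h5 ⊢
  set c := Nat.card (Set.range ρ)
  have hn' : (1 : ℝ) ≤ n := by exact_mod_cast (by omega : 1 ≤ n)
  have hn0 : (0 : ℝ) < n := by linarith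
  have h6 : Nat.card {X : Set (Atom ar (Fin n)) // ∃ e : Fin s ↪ Fin n, X ∈ Frame ar e ρ} ≤
      n ^ s * (2 ^ numAtoms ar (n - (s - c)) * 2 ^ numAtoms ar (16 * k)) := by
    refine (card_exists_le_mul (fun (e : Fin s ↪ Fin n) X => X ∈ Frame ar e ρ) (fun e =>
      (card_frame_le e ρ).trans (Nat.mul_le_mul
        (Nat.pow_le_pow_right two_pos (numAtoms_mono (card_range_collapse_le e ρ)))
        (Nat.pow_le_pow_right two_pos (numAtoms_mono (b := 16 * k) ?_))))).trans ?_
    · rw [Nat.card_fin]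
      omega
    · rw [Nat.card_fin, Nat.card_fin]
      refine Nat.mul_le_mul_right _ ?_
      rw [Nat.card_eq_fintype_card, Fintype.card_embedding_eq, Fintype.card_fin, Fintype.card_fin]
      exact Nat.descFactorial_le_pow _ _
  have h7 : (Nat.card {X : Set (Atom ar (Fin n)) // ∃ e : Fin s ↪ Fin n, X ∈ Frame ar e ρ} : ℝ) ≤
      (n : ℝ) ^ s * (2 ^ numAtoms ar (n - (s - c)) * 2 ^ numAtoms ar (16 * k)) := by
    exact_mod_cast h6
  have h8 : (n : ℝ) ^ s * 2 ^ numAtoms ar (n - (s - c)) ≤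
      ((1 / n : ℝ) + (n : ℝ) ^ (16 * k) * (1 / 2) ^ n) * scale ar k n := by
    unfold scale
    -- Either s-c > k and a factor 2^n is gained, or the pattern conditions leave only s = 2k-1, c =
    -- k-1, where one factor n is missing.
    rcases Nat.lt_or_ge k (s - c) with hd | hd
    · have h9 := numAtoms_gap (ar := ar) h2 (Nat.succ_le_of_lt hd) hn
      have h10 : (2 : ℝ) ^ numAtoms ar (n - (s - c)) ≤ (1 / 2) ^ n * 2 ^ numAtoms ar (n - k) := by
        rw [one_div, inv_pow, inv_mul_eq_div, le_div_iff₀ (by positivity), ← pow_add]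
        exact pow_le_pow_right₀ (by norm_num) h9
      calc _ ≤ (n : ℝ) ^ (16 * k) * ((1 / 2) ^ n * 2 ^ numAtoms ar (n - k)) := by
            gcongr
            omega
        _ = ((n : ℝ) ^ (16 * k) * (1 / 2) ^ n) * (1 * 2 ^ numAtoms ar (n - k)) := by ring
        _ ≤ _ := by
            gcongr
            · exact le_add_of_nonneg_left (by positivity)
            · exact one_le_pow₀ hn'
    · have hs : 2 * k = s + 1 := by omega
      have hd' : s - c = k := by omega
      rw [hd', hs, pow_succ]
      calc _ = (1 / n : ℝ) * ((n : ℝ) ^ s * n * 2 ^ numAtoms ar (n - k)) := by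
            field_simp
        _ ≤ _ := by
            gcongr
            exact le_add_of_nonneg_right (by positivity)
  calc _ ≤ _ := h7
    _ = 2 ^ numAtoms ar (16 * k) * ((n : ℝ) ^ s * 2 ^ numAtoms ar (n - (s - c))) := by ring
    _ ≤ 2 ^ numAtoms ar (16 * k) *
        (((1 / n : ℝ) + (n : ℝ) ^ (16 * k) * (1 / 2) ^ n) * scale ar k n) := by gcongr
    _ = _ := by ring

theorem card_smallExceptional_le (h2 : ∃ r, ar r = 2) {n k : ℕ} (hn : 2 * k + 1 ≤ n) :
    (Nat.card {X : Set (Atom ar (Fin n)) // SmallExceptional k X} : ℝ) ≤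
      Nat.card (OrbitPattern k) * (2 ^ numAtoms ar (16 * k) *
        ((1 / n : ℝ) + (n : ℝ) ^ (16 * k) * (1 / 2) ^ n) * scale ar k n) := by
  have := Fintype.ofFinite (OrbitPattern k)
  have h1 : Nat.card {X : Set (Atom ar (Fin n)) // SmallExceptional k X} ≤ _ :=
    (card_subtype_mono fun X hX => hX.2).trans (card_exists_le_sum _)
  refine (Nat.cast_le.2 h1).trans ?_
  push_cast
  refine (Finset.sum_le_sum fun j _ => card_frame_pattern_le h2 hn j).trans ?_
  simp

/-- The exceptional structures are negligible, the ones with large support even after multiplying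
by `n ^ (2k)`. -/
theorem tendsto_exceptional (har : ∀ r, ar r ≤ 2) (h2 : ∃ r, ar r = 2) {k : ℕ} (hk : 0 < k)
    (C D : ℝ) (hC : 0 ≤ C) (hD : 0 ≤ D) :
    Tendsto (fun n : ℕ =>
      ((C + (n : ℝ) ^ (2 * k)) * Nat.card {X : Set (Atom ar (Fin n)) // LargeSupport k X} +
        D * Nat.card {X : Set (Atom ar (Fin n)) // SmallExceptional k X}) / scale ar k n)
      atTop (𝓝 0) := by
  obtain ⟨β, hβ0, hβ⟩ : ∃ β : ℝ, 0 < β ∧ β ^ 4 = 1 / 2 :=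
    ⟨(1 / 2 : ℝ) ^ ((4 : ℕ) : ℝ)⁻¹, by positivity, Real.rpow_inv_natCast_pow (by norm_num) (by norm_num)⟩
  have hβ1 : |β| < 1 := by
    rw [abs_of_pos hβ0]
    by_contra h
    have := one_le_pow₀ (n := 4) (not_lt.1 h)
    rw [hβ] at this
    norm_num at this
  have hhalf : |(1 / 2 : ℝ)| < 1 := by rw [abs_of_pos] <;> norm_num
  have t3 := tendsto_pow_const_mul_const_pow_of_abs_lt_one 3 hβ1
  have t4 := tendsto_pow_const_mul_const_pow_of_abs_lt_one 4 hβ1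
  have th := tendsto_pow_const_mul_const_pow_of_abs_lt_one (16 * k) hhalf
  have t1 : Tendsto (fun n : ℕ => (1 / n : ℝ)) atTop (𝓝 0) := tendsto_one_div_atTop_nhds_zero_nat
  have hlim : Tendsto (fun n : ℕ => (C + 1) * ((n : ℝ) ^ 4 * β ^ n) +
      D * (Nat.card (OrbitPattern k) * (2 ^ numAtoms ar (16 * k) *
        ((1 / n : ℝ) + (n : ℝ) ^ (16 * k) * (1 / 2) ^ n)))) atTop (𝓝 0) := by
    have := (t4.const_mul (C + 1)).add
      ((((t1.add th).const_mul (2 ^ numAtoms ar (16 * k))).const_mul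
        (Nat.card (OrbitPattern k) : ℝ)).const_mul D)
    simpa using this
  refine squeeze_zero' (Eventually.of_forall fun n => by unfold scale; positivity) ?_ hlim
  filter_upwards [eventually_ge_atTop (2 * k + 1), t3.eventually (ge_mem_nhds one_pos)]
    with n hn hsmall
  have hn' : (1 : ℝ) ≤ n := by exact_mod_cast (by omega : 1 ≤ n)
  have hn0 : (0 : ℝ) < n := by linarith
  have hsc : 0 < scale ar k n := by unfold scale; positivity
  have hp : (1 : ℝ) ≤ (n : ℝ) ^ (2 * k) := one_le_pow₀ hn'
  rw [div_le_iff₀ hsc, add_mul ((C + 1) * _)]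
  apply add_le_add
  · have h3 := card_largeSupport_le har h2 hβ0 hβ hk (by omega) hsmall
    have h4 : (C + (n : ℝ) ^ (2 * k)) ≤ (C + 1) * (n : ℝ) ^ (2 * k) := by nlinarith
    calc _ ≤ (C + 1) * (n : ℝ) ^ (2 * k) *
          Nat.card {X : Set (Atom ar (Fin n)) // LargeSupport k X} := by gcongr
      _ ≤ (C + 1) * ((n : ℝ) ^ 4 * β ^ n * 2 ^ numAtoms ar (n - k)) := by
          rw [mul_assoc]
          gcongr
      _ = (C + 1) * ((n : ℝ) ^ 4 * β ^ n) * (1 * 2 ^ numAtoms ar (n - k)) := by ring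
      _ ≤ _ := by
          unfold scale
          gcongr
  · rw [mul_assoc, mul_assoc]
    refine mul_le_mul_of_nonneg_left ?_ hD
    exact card_smallExceptional_le h2 hn

end Bounds

/-! ### Double counting and the limiting ratios. -/

section Pairs
variable {E α : Type*} [Finite E] [Finite α]

theorem card_pairs_eq_mul (P : E → α → Prop) (Q : α → Prop) {C : ℕ} (hPQ : ∀ e x, P e x → Q x)
    (h : ∀ x, Q x → Nat.card {e // P e x} = C) :
    Nat.card {p : E × α // P p.1 p.2} = C * Nat.card {x // Q x} := by
  have := Fintype.ofFinite {x // Q x}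
  have e : {p : E × α // P p.1 p.2} ≃ Σ x : {x // Q x}, {e // P e x.1} :=
    { toFun := fun p => ⟨⟨p.1.2, hPQ _ _ p.2⟩, p.1.1, p.2⟩
      invFun := fun y => ⟨(y.2.1, y.1.1), y.2.2⟩
      left_inv := fun _ => rfl
      right_inv := fun _ => rfl }
  rw [Nat.card_congr e, Nat.card_sigma, Finset.sum_congr rfl fun x _ => h x.1 x.2]
  simp [mul_comm]

theorem card_pairs_le_mul (P : E → α → Prop) (Q : α → Prop) {C : ℕ} (hPQ : ∀ e x, P e x → Q x)
    (h : ∀ x, Q x → Nat.card {e // P e x} ≤ C) :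
    Nat.card {p : E × α // P p.1 p.2} ≤ C * Nat.card {x // Q x} := by
  have := Fintype.ofFinite {x // Q x}
  have e : {p : E × α // P p.1 p.2} ≃ Σ x : {x // Q x}, {e // P e x.1} :=
    { toFun := fun p => ⟨⟨p.1.2, hPQ _ _ p.2⟩, p.1.1, p.2⟩
      invFun := fun y => ⟨(y.2.1, y.1.1), y.2.2⟩
      left_inv := fun _ => rfl
      right_inv := fun _ => rfl }
  rw [Nat.card_congr e, Nat.card_sigma]
  refine (Finset.sum_le_sum fun x _ => h x.1 x.2).trans_eq ?_
  simp [mul_comm]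

end Pairs

section Limit
variable {R : Type*} [Fintype R] {ar : R → ℕ}

/-- The number of pairs of an enumeration `e` of `k` pairs and a structure in the frame of `e` with
no atoms inside the range of `e`. -/
noncomputable def frameCount (ar : R → ℕ) (k n : ℕ) : ℕ :=
  ∑ e : Fin k × ZMod 2 ↪ Fin n,
    Nat.card {X : Set (Atom ar (Fin n)) // X ∈ Frame ar e pairBase ∧ Atom.map e ⁻¹' X = ∅}

theorem card_framed (k n : ℕ) (Q : Set (Set (Atom ar (Fin k × ZMod 2)))) :
    Nat.card {p : (Fin k × ZMod 2 ↪ Fin n) × Set (Atom ar (Fin n)) //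
      p.2 ∈ Frame ar p.1 pairBase ∧ Atom.map p.1 ⁻¹' p.2 ∈ Q} = Nat.card Q * frameCount ar k n := by
  rw [card_pairs (fun e X => X ∈ Frame ar e pairBase ∧ Atom.map e ⁻¹' X ∈ Q), frameCount,
    Finset.mul_sum]
  exact Finset.sum_congr rfl fun e _ => card_frame_comap e pairBase Q

theorem card_embedding_pairs (k n : ℕ) :
    Nat.card (Fin k × ZMod 2 ↪ Fin n) = n.descFactorial (2 * k) := by
  rw [Nat.card_eq_fintype_card, Fintype.card_embedding_eq]
  simp [mul_comm]

theorem card_range_pairBase (k : ℕ) :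
    Nat.card (Set.range (pairBase : Fin k × ZMod 2 → _)) = k := by
  have : Set.range (pairBase : Fin k × ZMod 2 → _) = Set.range fun j : Fin k => (j, (0 : ZMod 2)) :=
    Set.ext fun p => ⟨fun ⟨q, hq⟩ => ⟨q.1, hq⟩, fun ⟨j, hj⟩ => ⟨(j, 0), hj⟩⟩
  rw [this, Nat.card_range_of_injective fun i j h => congrArg Prod.fst h, Nat.card_fin]

/-- This makes errors that are small against `scale` small against `frameCount`. Each enumeration
contributes at least 2^N(n-k) up to the constant for the inner atoms, and for n ≥ 4k the falling
factorial is comparable to n^(2k). -/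
theorem scale_le_frameCount {k n : ℕ} (hn : 4 * k ≤ n) :
    scale ar k n ≤ 2 ^ (2 * k) * 2 ^ numAtoms ar (2 * k) * frameCount ar k n := by
  have hι : Nat.card (Fin k × ZMod 2) = 2 * k := by simp [mul_comm]
  have h1 : n.descFactorial (2 * k) * 2 ^ numAtoms ar (n - k) ≤
      2 ^ numAtoms ar (2 * k) * frameCount ar k n := by
    rw [← card_embedding_pairs, ← hι, ← card_set_atom, frameCount, Finset.mul_sum]
    have : ∀ e : Fin k × ZMod 2 ↪ Fin n, 2 ^ numAtoms ar (n - k) ≤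
        Nat.card (Set (Atom ar (Fin k × ZMod 2))) * Nat.card {X : Set (Atom ar (Fin n)) //
          X ∈ Frame ar e pairBase ∧ Atom.map e ⁻¹' X = ∅} := by
      intro e
      have h2 := card_frame_comap (ar := ar) e pairBase Set.univ
      rw [Nat.card_univ] at h2
      rw [← h2]
      simp only [Set.mem_univ, and_true]
      refine le_trans (Nat.pow_le_pow_right two_pos (numAtoms_mono ?_))
        (le_card_frame e pairBase fun p => rfl)
      refine le_trans ?_ (le_card_range_collapse e pairBase fun p => rfl)
      rw [Nat.card_fin, hι, card_range_pairBase]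
      omega
    refine le_trans ?_ (Finset.sum_le_sum fun e _ => this e)
    simp [Nat.card_eq_fintype_card]
  have h2 : n ^ (2 * k) ≤ 2 ^ (2 * k) * n.descFactorial (2 * k) := by
    refine le_trans ?_ (Nat.mul_le_mul_left _ (Nat.pow_sub_le_descFactorial n (2 * k)))
    rw [← mul_pow]
    exact Nat.pow_le_pow_left (by omega) _
  have h3 : n ^ (2 * k) * 2 ^ numAtoms ar (n - k) ≤
      2 ^ (2 * k) * 2 ^ numAtoms ar (2 * k) * frameCount ar k n := by
    calc _ ≤ 2 ^ (2 * k) * n.descFactorial (2 * k) * 2 ^ numAtoms ar (n - k) :=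
          Nat.mul_le_mul_right _ h2
      _ = 2 ^ (2 * k) * (n.descFactorial (2 * k) * 2 ^ numAtoms ar (n - k)) := by ring
      _ ≤ _ := by
        rw [mul_assoc]
        exact Nat.mul_le_mul_left _ h1
  unfold scale
  exact_mod_cast h3

/-- With large support any enumeration is allowed, which costs n^(2k); otherwise the enumeration
takes values among at most 16k moved elements, which costs only a constant. -/
theorem card_exceptional_pairs_le (har : ∀ r, ar r ≤ 2) {k m : ℕ} (hm : 2 * k ≤ m + 1) (n : ℕ) :
    Nat.card {p : (Fin k × ZMod 2 ↪ Fin n) × Set (Atom ar (Fin n)) //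
      Set.range p.1 ⊆ moved p.2 ∧ Exceptional k m p.2} ≤
    n ^ (2 * k) * Nat.card {X : Set (Atom ar (Fin n)) // LargeSupport k X} +
      (16 * k) ^ (2 * k) * Nat.card {X : Set (Atom ar (Fin n)) // SmallExceptional k X} := by
  refine le_trans (card_subtype_mono
    (Q := fun p : (Fin k × ZMod 2 ↪ Fin n) × Set (Atom ar (Fin n)) =>
      LargeSupport k p.2 ∨ (Set.range p.1 ⊆ moved p.2 ∧ SmallExceptional k p.2))
    fun p (hp : _ ∧ _) => ?_) ((card_or_le _ _).trans (add_le_add ?_ ?_))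
  · exact (hp.2.large_or_small har hm).imp_right fun h => ⟨hp.1, h⟩
  · refine card_pairs_le_mul (E := Fin k × ZMod 2 ↪ Fin n)
      (fun _ (X : Set (Atom ar (Fin n))) => LargeSupport k X) _ (fun _ _ h => h) fun X _ => ?_
    refine (Nat.card_le_card_of_injective Subtype.val Subtype.val_injective).trans ?_
    rw [card_embedding_pairs]
    exact Nat.descFactorial_le_pow _ _
  · refine card_pairs_le_mul (E := Fin k × ZMod 2 ↪ Fin n)
      (fun e (X : Set (Atom ar (Fin n))) => Set.range e ⊆ moved X ∧ SmallExceptional k X) _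
      (fun _ _ h => h.2) fun X hX => ?_
    refine (Nat.card_le_card_of_injective (β := Fin k × ZMod 2 → moved X)
      (fun e p => ⟨e.1 p, e.2.1 ⟨p, rfl⟩⟩) ?_).trans ?_
    · intro e e' h
      ext p
      exact congrArg Fin.val (congrArg Subtype.val (congrFun h p))
    · have hι : Nat.card (Fin k × ZMod 2) = 2 * k := by simp [mul_comm]
      rw [Nat.card_fun, hι, Nat.card_coe_set_eq]
      exact Nat.pow_le_pow_left hX.1 _

/-- Counting a class of structures with at least `m` moved elements, where membership of the
structures whose orbits form `k` pairs depends only on the substructure on these pairs. -/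
theorem tendsto_card_class (har : ∀ r, ar r ≤ 2) (h2 : ∃ r, ar r = 2) {k m : ℕ} (hk : 0 < k)
    (hm : 2 * k ≤ m + 1) (hm' : m ≤ 2 * k) (D : ∀ n, Set (Atom ar (Fin n)) → Prop)
    (Q : Set (Set (Atom ar (Fin k × ZMod 2))))
    (hD : ∀ n X, D n X → m ≤ (moved X).ncard) (hQ : ∀ A ∈ Q, FlipsCover A)
    (hDQ : ∀ n X (e : Fin k × ZMod 2 ↪ Fin n), Adapted e X → (D n X ↔ Atom.map e ⁻¹' X ∈ Q)) :
    Tendsto (fun n : ℕ => (Nat.card (PairPerm k) * Nat.card {X // D n X} : ℝ) /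
      frameCount ar k n) atTop (𝓝 (Nat.card Q : ℝ)) := by
  set K := Nat.card (PairPerm k)
  let L : ℕ → ℕ := fun n => Nat.card {X : Set (Atom ar (Fin n)) // LargeSupport k X}
  let S : ℕ → ℕ := fun n => Nat.card {X : Set (Atom ar (Fin n)) // SmallExceptional k X}
  have hadapted : ∀ n, Nat.card {p : (Fin k × ZMod 2 ↪ Fin n) × Set (Atom ar (Fin n)) //
      Adapted p.1 p.2 ∧ D n p.2} = K * Nat.card {X // D n X ∧
        ∃ e : Fin k × ZMod 2 ↪ Fin n, Adapted e X} := by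
    intro n
    refine card_pairs_eq_mul (fun e X => Adapted e X ∧ D n X) _
      (fun e X h => ⟨h.2, e, h.1⟩) ?_
    rintro X ⟨hX, e, he⟩
    simp only [hX, and_true]
    exact he.card_adapted
  -- An adapted enumeration of a structure in the class is framed with inner part in `Q`; structures
  -- without one are exceptional.
  have hupper : ∀ n, K * Nat.card {X // D n X} ≤
      Nat.card Q * frameCount ar k n + K * (L n + S n) := by
    intro n
    have h3 : Nat.card {X // D n X} ≤ Nat.card {X // D n X ∧
        ∃ e : Fin k × ZMod 2 ↪ Fin n, Adapted e X} + (L n + S n) := by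
      refine le_trans (card_subtype_mono (Q := fun X => (D n X ∧
        ∃ e : Fin k × ZMod 2 ↪ Fin n, Adapted e X) ∨ (LargeSupport k X ∨ SmallExceptional k X))
        fun X hX => ?_) ((card_or_le _ _).trans (Nat.add_le_add_left (card_or_le _ _) _))
      by_cases he : ∃ e : Fin k × ZMod 2 ↪ Fin n, Adapted e X
      · exact Or.inl ⟨hX, he⟩
      · exact Or.inr (Exceptional.large_or_small har hm ⟨hD n X hX, not_exists.1 he⟩)
    refine (Nat.mul_le_mul_left K h3).trans ?_
    rw [mul_add, ← hadapted, ← card_framed]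
    refine Nat.add_le_add_right (card_subtype_mono fun p hp => ?_) _
    exact ⟨hp.1.mem_frame har, (hDQ n _ _ hp.1).1 hp.2⟩
  -- A framed pair with inner part in `Q` is adapted as soon as the structure has any adapted
  -- enumeration; otherwise it is an exceptional pair.
  have hlower : ∀ n, Nat.card Q * frameCount ar k n ≤ K * Nat.card {X // D n X} +
      (n ^ (2 * k) * L n + (16 * k) ^ (2 * k) * S n) := by
    intro n
    rw [← card_framed]
    refine le_trans (card_subtype_mono (Q := fun p => (Adapted p.1 p.2 ∧ D n p.2) ∨
      (Set.range p.1 ⊆ moved p.2 ∧ Exceptional k m p.2)) fun p hp => ?_)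
      ((card_or_le _ _).trans (add_le_add ?_ (card_exceptional_pairs_le har hm n)))
    · have hcover := hQ _ hp.2
      by_cases he : ∃ e : Fin k × ZMod 2 ↪ Fin n, Adapted e p.2
      · obtain ⟨e, he⟩ := he
        have := he.of_flipsCover hp.1 hcover
        exact Or.inl ⟨this, (hDQ n _ _ this).2 hp.2⟩
      · have hsub := range_subset_moved hp.1 hcover
        refine Or.inr ⟨hsub, hm'.trans ?_, not_exists.1 he⟩
        have := Set.ncard_le_ncard hsub (Set.toFinite _)
        rw [← Set.image_univ, Set.ncard_image_of_injective _ p.1.injective,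
          Set.ncard_univ, Nat.card_prod] at this
        simpa [mul_comm] using this
    · rw [hadapted]
      exact Nat.mul_le_mul_left K (card_subtype_mono fun X hX => hX.1)
  let c : ℝ := 2 ^ (2 * k) * 2 ^ numAtoms ar (2 * k)
  have hlim := (tendsto_exceptional (ar := ar) har h2 hk (C := K) (D := K + (16 * k : ℕ) ^ (2 * k))
    (by positivity) (by positivity)).const_mul c
  rw [mul_zero] at hlim
  rw [tendsto_iff_norm_sub_tendsto_zero]
  refine squeeze_zero' (Eventually.of_forall fun n => norm_nonneg _) ?_ hlim
  filter_upwards [eventually_ge_atTop (4 * k + 1)] with n hn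
  have hn0 : (0 : ℝ) < n := by exact_mod_cast (by omega : 0 < n)
  have hs : 0 < scale ar k n := by unfold scale; positivity
  have hsF := scale_le_frameCount (ar := ar) (k := k) (n := n) (by omega)
  have hF : (0 : ℝ) < frameCount ar k n :=
    pos_of_mul_pos_right (hs.trans_le hsF) (by positivity)
  have hu : (K * Nat.card {X // D n X} : ℝ) ≤
      Nat.card Q * frameCount ar k n + K * (L n + S n) := by exact_mod_cast hupper n
  have hl : (Nat.card Q * frameCount ar k n : ℝ) ≤ K * Nat.card {X // D n X} +
      ((n : ℝ) ^ (2 * k) * L n + (16 * k : ℕ) ^ (2 * k) * S n) := by exact_mod_cast hlower n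
  set err : ℝ := (K + (n : ℝ) ^ (2 * k)) * L n + (K + (16 * k : ℕ) ^ (2 * k)) * S n
  have herr : |(K * Nat.card {X // D n X} : ℝ) - Nat.card Q * frameCount ar k n| ≤ err := by
    have e1 : (0 : ℝ) ≤ (n : ℝ) ^ (2 * k) * L n := by positivity
    have e2 : (0 : ℝ) ≤ ((16 * k : ℕ) : ℝ) ^ (2 * k) * S n := by positivity
    have e3 : (0 : ℝ) ≤ (K : ℝ) * L n := by positivity
    have e4 : (0 : ℝ) ≤ (K : ℝ) * S n := by positivity
    rw [abs_le]
    constructor <;> simp only [err] <;> linarith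
  have herr0 : 0 ≤ err := (abs_nonneg _).trans herr
  rw [div_sub' hF.ne', Real.norm_eq_abs, abs_div, abs_of_pos hF, div_le_iff₀ hF,
    mul_comm (frameCount ar k n : ℝ)]
  refine herr.trans ?_
  calc err = err / scale ar k n * scale ar k n := by field_simp
    _ ≤ err / scale ar k n * (c * frameCount ar k n) := by gcongr
    _ = _ := by ring

/-- The factors `Nat.card (PairPerm k)` and `frameCount ar k n` are common to both counts and
cancel. -/
theorem tendsto_ratio (har : ∀ r, ar r ≤ 2) (h2 : ∃ r, ar r = 2) {k m : ℕ} (hk : 0 < k)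
    (hm : 2 * k ≤ m + 1) (hm' : m ≤ 2 * k) (D D' : ∀ n, Set (Atom ar (Fin n)) → Prop)
    (Q Q' : Set (Set (Atom ar (Fin k × ZMod 2)))) (hne : Q.Nonempty)
    (hD : ∀ n X, D n X → m ≤ (moved X).ncard) (hQ : ∀ A ∈ Q, FlipsCover A)
    (hDQ : ∀ n X (e : Fin k × ZMod 2 ↪ Fin n), Adapted e X → (D n X ↔ Atom.map e ⁻¹' X ∈ Q))
    (hDD' : ∀ n X, D' n X → D n X) (hQQ' : Q' ⊆ Q)
    (hDQ' : ∀ n X (e : Fin k × ZMod 2 ↪ Fin n), Adapted e X → (D' n X ↔ Atom.map e ⁻¹' X ∈ Q')) :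
    Tendsto (fun n : ℕ => (Nat.card {X // D' n X} : ℝ) / Nat.card {X // D n X}) atTop
      (𝓝 (Nat.card Q' / Nat.card Q : ℝ)) := by
  have hQ0 : (Nat.card Q : ℝ) ≠ 0 := by
    have : Nonempty Q := hne.to_subtype
    exact_mod_cast Nat.card_pos.ne'
  have hK : (Nat.card (PairPerm k) : ℝ) ≠ 0 := by exact_mod_cast (card_pairPerm_pos (k := k)).ne'
  have t1 := tendsto_card_class har h2 hk hm hm' D Q hD hQ hDQ
  have t2 := tendsto_card_class har h2 hk hm hm' D' Q' (fun n X h => hD n X (hDD' n X h))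
    (fun A hA => hQ A (hQQ' hA)) hDQ'
  refine (t2.div t1 hQ0).congr' ?_
  filter_upwards [eventually_ge_atTop (4 * k + 1)] with n hn
  have hn0 : (0 : ℝ) < n := by exact_mod_cast (by omega : 0 < n)
  have hs : 0 < scale ar k n := by unfold scale; positivity
  have hsF := scale_le_frameCount (ar := ar) (k := k) (n := n) (by omega)
  have hF : (0 : ℝ) < frameCount ar k n :=
    pos_of_mul_pos_right (hs.trans_le hsF) (by positivity)
  rw [Pi.div_apply, div_div_div_cancel_right₀ hF.ne', mul_div_mul_left _ _ hK]

end Limit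

/-! ### Realising every dimension of the flip space. -/

section Blocks
variable {k : ℕ} {R : Type*} {ar : R → ℕ}

/-- The structure on `k` pairs in which every relation says that the entries are on the same side
of pairs lying in the same block. -/
def blockStructure {β : Type*} (ar : R → ℕ) (b : Fin k → β) : Set (Atom ar (Fin k × ZMod 2)) :=
  {a | ∀ p q, b (a.2 p).1 = b (a.2 q).1 ∧ (a.2 p).2 = (a.2 q).2}

/-- The binary atom on (i, 0) and (j, 0) forces the flip to agree on i and j in one block.
Conversely, flips constant on blocks preserve being on the same side. -/
theorem mem_flipSubmodule_blockStructure {β : Type*} (h2 : ∃ r, ar r = 2) (b : Fin k → β)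
    (v : Fin k → ZMod 2) :
    v ∈ flipSubmodule (blockStructure ar b) ↔ ∀ i j, b i = b j → v i = v j := by
  constructor
  · intro hv i j hij
    obtain ⟨r, hr⟩ := h2
    let a : Atom ar (Fin k × ZMod 2) := ⟨r, fun p => if p.1 = 0 then (i, 0) else (j, 0)⟩
    have ha : a ∈ blockStructure ar b := by
      intro p q
      dsimp only [a]
      split_ifs <;> simp [hij]
    have := (((hv a).2 ha) ⟨0, by change 0 < ar r; omega⟩ ⟨1, by change 1 < ar r; omega⟩).2
    simpa [a, Atom.map, pairFlip_apply] using this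
  · intro hv a
    refine forall_congr' fun p => forall_congr' fun q => ?_
    change _ ∧ (a.2 p).2 + v (a.2 p).1 = (a.2 q).2 + v (a.2 q).1 ↔ _
    refine and_congr_right fun hb => ?_
    have hb' : v (a.2 p).1 = v (a.2 q).1 := hv _ _ hb
    exact hb' ▸ add_left_inj _

theorem finrank_flipSubmodule_blockStructure {i : ℕ} (h2 : ∃ r, ar r = 2) (b : Fin k → Fin i)
    (hb : Function.Surjective b) :
    Module.finrank (ZMod 2) (flipSubmodule (blockStructure ar b)) = i := by
  have : flipSubmodule (blockStructure ar b) =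
      LinearMap.range (LinearMap.funLeft (ZMod 2) (ZMod 2) b) := by
    ext v
    rw [mem_flipSubmodule_blockStructure h2, LinearMap.mem_range]
    constructor
    · intro hv
      exact ⟨fun x => v (Function.surjInv hb x), funext fun j =>
        hv _ _ (Function.surjInv_eq hb (b j))⟩
    · rintro ⟨w, rfl⟩ x y hxy
      exact congrArg w hxy
  rw [this, LinearMap.finrank_range_of_inj
    (LinearMap.funLeft_injective_of_surjective _ _ _ hb), Module.finrank_fin_fun]

/-- Every dimension between `1` and `k` is the dimension of the flips of some structure that is
invariant under exchanging all pairs. -/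
theorem exists_finrank_flipSubmodule (h2 : ∃ r, ar r = 2) {i : ℕ} (hi : 1 ≤ i) (hik : i ≤ k) :
    ∃ A : Set (Atom ar (Fin k × ZMod 2)), 1 ∈ flipSubmodule A ∧
      Module.finrank (ZMod 2) (flipSubmodule A) = i := by
  -- The first i-1 pairs form singleton blocks and all remaining pairs share the last block.
  let b : Fin k → Fin i := fun j => ⟨min j (i - 1), by omega⟩
  have hb : Function.Surjective b := fun x =>
    ⟨⟨x, by omega⟩, Fin.ext (by have := x.2; simp [b]; omega)⟩
  exact ⟨blockStructure ar b, (mem_flipSubmodule_blockStructure h2 b 1).2 fun _ _ _ => rfl,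
    finrank_flipSubmodule_blockStructure h2 b hb⟩

theorem flipsCover_of_one_mem {A : Set (Atom ar (Fin k × ZMod 2))} (h : 1 ∈ flipSubmodule A) :
    FlipsCover A := fun _ => ⟨1, h, one_ne_zero⟩

theorem finrank_flipSubmodule_le (A : Set (Atom ar (Fin k × ZMod 2))) :
    Module.finrank (ZMod 2) (flipSubmodule A) ≤ k := by
  simpa using Submodule.finrank_le (flipSubmodule A)

theorem FlipsCover.one_le_finrank {A : Set (Atom ar (Fin k × ZMod 2))} (h : FlipsCover A)
    (hk : 0 < k) : 1 ≤ Module.finrank (ZMod 2) (flipSubmodule A) := by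
  rw [Submodule.one_le_finrank_iff]
  intro h0
  obtain ⟨v, hv, hv0⟩ := h ⟨0, hk⟩
  rw [h0, Submodule.mem_bot] at hv
  exact hv0 (congrFun hv _)

end Blocks

/-! ### From sets of atoms back to first-order structures. -/

section Translation
variable {L : FirstOrder.Language} {V : Type*}

/-- The arities of the relation symbols of a language. -/
abbrev relArity (L : FirstOrder.Language) : (Σ l, L.Relations l) → ℕ := Sigma.fst

/-- The atoms true in a structure. -/
def trueAtoms (M : L.Structure V) : Set (Atom (relArity L) V) := {a | M.RelMap a.1.2 a.2}

/-- Structures for a relational language correspond to sets of atoms. -/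
def structureEquiv [L.IsRelational] : L.Structure V ≃ Set (Atom (relArity L) V) where
  toFun := trueAtoms
  invFun X := { funMap := fun f => isEmptyElim f, RelMap := fun r x => ⟨⟨_, r⟩, x⟩ ∈ X }
  left_inv M := by
    apply FirstOrder.Language.Structure.ext
    · funext n f
      exact isEmptyElim f
    · rfl
  right_inv X := rfl

theorem mem_autGroup_iff [L.IsRelational] {M : L.Structure V} {f : Equiv.Perm V} :
    f ∈ autGroup M ↔ f ∈ aut (trueAtoms M) := by
  let := M
  constructor
  · rintro ⟨g, rfl⟩ a
    exact g.map_rel a.1.2 a.2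
  · intro hf
    exact ⟨{ toEquiv := f
             map_fun' := fun g => isEmptyElim g
             map_rel' := fun r x => hf ⟨⟨_, r⟩, x⟩ }, rfl⟩

theorem autGroup_eq [L.IsRelational] (M : L.Structure V) : autGroup M = aut (trueAtoms M) :=
  Subgroup.ext fun _ => mem_autGroup_iff

theorem sptStar_eq [L.IsRelational] {n : ℕ} (M : L.Structure (Fin n)) :
    sptStar M = (moved (trueAtoms M)).ncard := by
  have : SptStar M = moved (trueAtoms M) := by
    ext a
    simp only [SptStar, moved, Set.mem_ofPred_eq, mem_autGroup_iff, Equiv.Perm.mem_support]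
  rw [sptStar, this]

theorem le_spt_iff [L.IsRelational] {n m : ℕ} (M : L.Structure (Fin n)) :
    m ≤ spt M ↔ ∃ f ∈ aut (trueAtoms M), m ≤ f.support.card := by
  have hbdd : BddAbove {k | ∃ f ∈ autGroup M, f.support.card = k} := by
    refine ⟨n, ?_⟩
    rintro _ ⟨f, -, rfl⟩
    simpa using f.support.card_le_univ
  have hne : {k | ∃ f ∈ autGroup M, f.support.card = k}.Nonempty := ⟨_, 1, one_mem _, rfl⟩
  rw [← autGroup_eq]
  constructor
  · intro h
    obtain ⟨f, hf, hfk⟩ := Nat.sSup_mem hne hbdd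
    exact ⟨f, hf, h.trans_eq hfk.symm⟩
  · rintro ⟨f, hf, hm⟩
    exact hm.trans (le_csSup hbdd ⟨f, hf, rfl⟩)

theorem le_ncard_moved_of_support {R : Type*} {ar : R → ℕ} [Fintype V] [DecidableEq V] {m : ℕ}
    {X : Set (Atom ar V)} (h : ∃ f ∈ aut X, m ≤ f.support.card) : m ≤ (moved X).ncard := by
  obtain ⟨f, hf, hm⟩ := h
  refine hm.trans ?_
  rw [← Set.ncard_coe_finset]
  exact Set.ncard_le_ncard (fun a ha => ⟨f, hf, Equiv.Perm.mem_support.1 ha⟩) (Set.toFinite _)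

/-- The automorphism group has 2^d elements, d being the dimension of the flip space, so its order
determines the exponent; a basis supplies the converse. -/
theorem autIsoZ2Pow_iff [L.IsRelational] (har : ∀ r, relArity L r ≤ 2) {k i : ℕ} {M : L.Structure V}
    {e : Fin k × ZMod 2 ↪ V} (he : Adapted e (trueAtoms M)) :
    AutIsoZ2Pow M i ↔
      Module.finrank (ZMod 2) (flipSubmodule (Atom.map e ⁻¹' trueAtoms M)) = i := by
  obtain ⟨φ⟩ := he.nonempty_mulEquiv har
  rw [← autGroup_eq] at φ
  constructor
  · rintro ⟨ψ⟩
    have h1 := Nat.card_congr (φ.trans ψ).toEquiv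
    have h2 := Module.natCard_eq_pow_finrank (K := ZMod 2)
      (V := flipSubmodule (Atom.map e ⁻¹' trueAtoms M))
    have h3 : Nat.card (Multiplicative (Fin i → ZMod 2)) = 2 ^ i := by
      rw [Nat.card_congr Multiplicative.toAdd, Nat.card_fun]
      simp
    rw [h3, Nat.card_congr Multiplicative.toAdd, h2, Nat.card_zmod] at h1
    exact Nat.pow_right_injective le_rfl h1
  · rintro rfl
    exact ⟨φ.symm.trans (AddEquiv.toMultiplicative
      (Module.finBasis (ZMod 2) _).equivFun.toAddEquiv)⟩

theorem proportion_eq [L.IsRelational] (C P : StructureProperty L) (n : ℕ) :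
    proportion C P n =
      (Nat.card {X : Set (Atom (relArity L) (Fin n)) //
        C n (structureEquiv.symm X) ∧ P n (structureEquiv.symm X)} : ℝ) /
      Nat.card {X : Set (Atom (relArity L) (Fin n)) // C n (structureEquiv.symm X)} := by
  rw [proportion, Nat.card_congr (structureEquiv.subtypeEquiv fun M => ?_),
    Nat.card_congr (structureEquiv.subtypeEquiv (p := C n) fun M => ?_)]
  · rw [Equiv.symm_apply_apply]
  · rw [Equiv.symm_apply_apply]

theorem tendsto_proportion [L.IsRelational] [Finite L.Symbols]
    (maxArity : IsGreatest {j : ℕ | Nonempty (L.Relations j)} 2) {k m : ℕ} (hk : 0 < k)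
    (hm : 2 * k ≤ m + 1) (hm' : m ≤ 2 * k) (C P : StructureProperty L)
    (Q Q' : Set (Set (Atom (relArity L) (Fin k × ZMod 2)))) (hne : Q.Nonempty)
    (hC : ∀ n M, C n M → m ≤ sptStar M) (hQ : ∀ A ∈ Q, FlipsCover A)
    (hCQ : ∀ n M (e : Fin k × ZMod 2 ↪ Fin n), Adapted e (trueAtoms M) →
      (C n M ↔ Atom.map e ⁻¹' trueAtoms M ∈ Q))
    (hCQ' : ∀ n M (e : Fin k × ZMod 2 ↪ Fin n), Adapted e (trueAtoms M) →
      (P n M ↔ Atom.map e ⁻¹' trueAtoms M ∈ Q')) :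
    Tendsto (proportion C P) atTop (𝓝 (Nat.card ↥(Q ∩ Q') / Nat.card Q : ℝ)) := by
  have : Finite (Σ l, L.Relations l) :=
    Finite.of_injective (Sum.inr : _ → L.Symbols) Sum.inr_injective
  have := Fintype.ofFinite (Σ l, L.Relations l)
  have har : ∀ r, relArity L r ≤ 2 := fun r => maxArity.2 ⟨r.2⟩
  have h2 : ∃ r, relArity L r = 2 := by
    obtain ⟨r⟩ := maxArity.1
    exact ⟨⟨2, r⟩, rfl⟩
  refine (tendsto_ratio har h2 hk hm hm' (fun n X => C n (structureEquiv.symm X))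
    (fun n X => C n (structureEquiv.symm X) ∧ P n (structureEquiv.symm X)) Q (Q ∩ Q') hne
    (fun n X hX => (hC n _ hX).trans_eq (sptStar_eq _)) hQ
    (fun n X e he => hCQ n (structureEquiv.symm X) e he) (fun n X h => h.1) Set.inter_subset_left
    (fun n X e he => and_congr (hCQ n (structureEquiv.symm X) e he)
      (hCQ' n (structureEquiv.symm X) e he))).congr fun n => (proportion_eq C P n).symm

/-- The conclusion for a class of structures with `spt* ≥ m` in which membership of the structures
with automorphism orbits forming `k` pairs is determined by the structure on these pairs. -/
theorem limits_of_class [L.IsRelational] [Finite L.Symbols]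
    (maxArity : IsGreatest {j : ℕ | Nonempty (L.Relations j)} 2) {k m : ℕ} (hk : 0 < k)
    (hm : 2 * k ≤ m + 1) (hm' : m ≤ 2 * k) (C : StructureProperty L)
    (Q : Set (Set (Atom (relArity L) (Fin k × ZMod 2))))
    (hC : ∀ n M, C n M → m ≤ sptStar M) (hQ : ∀ A ∈ Q, FlipsCover A)
    (hone : ∀ A, 1 ∈ flipSubmodule A → A ∈ Q)
    (hCQ : ∀ n M (e : Fin k × ZMod 2 ↪ Fin n), Adapted e (trueAtoms M) →
      (C n M ↔ Atom.map e ⁻¹' trueAtoms M ∈ Q)) :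
    AlmostAll C (fun _ M => sptStar M = 2 * k ∧ ∃ i, 1 ≤ i ∧ i ≤ k ∧ AutIsoZ2Pow M i) ∧
      ∀ i, 1 ≤ i → i ≤ k → ∃ a : ℚ, 0 < a ∧ a ≤ 1 ∧ (2 < m → a < 1) ∧
        Tendsto (proportion C (fun _ M => AutIsoZ2Pow M i)) atTop (𝓝 (a : ℝ)) := by
  have : Finite (Σ l, L.Relations l) :=
    Finite.of_injective (Sum.inr : _ → L.Symbols) Sum.inr_injective
  have har : ∀ r, relArity L r ≤ 2 := fun r => maxArity.2 ⟨r.2⟩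
  have h2 : ∃ r, relArity L r = 2 := by
    obtain ⟨r⟩ := maxArity.1
    exact ⟨⟨2, r⟩, rfl⟩
  have hex : ∀ i, 1 ≤ i → i ≤ k → ∃ A ∈ Q, Module.finrank (ZMod 2) (flipSubmodule A) = i := by
    intro i hi hik
    obtain ⟨A, hA, hAi⟩ := exists_finrank_flipSubmodule h2 hi hik
    exact ⟨A, hone A hA, hAi⟩
  have hne : Q.Nonempty := by
    obtain ⟨A, hA, -⟩ := hex 1 le_rfl hk
    exact ⟨A, hA⟩
  have hQ0 : 0 < Nat.card Q := by
    have := hne.to_subtype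
    exact Nat.card_pos
  constructor
  · have := tendsto_proportion maxArity hk hm hm' C
      (fun _ M => sptStar M = 2 * k ∧ ∃ i, 1 ≤ i ∧ i ≤ k ∧ AutIsoZ2Pow M i) Q Set.univ hne hC hQ hCQ
      -- Every structure with an adapted enumeration has the property, so the condition on the inner
      -- part is void and the limit is |Q|/|Q| = 1.
      (fun n M e he => by
        refine iff_of_true ⟨by rw [sptStar_eq, he.ncard_moved], _,
          he.flipsCover.one_le_finrank hk, finrank_flipSubmodule_le _,
          (autIsoZ2Pow_iff har he).2 rfl⟩ (Set.mem_univ _))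
    rwa [Set.inter_univ, div_self (by exact_mod_cast hQ0.ne')] at this
  · intro i hi hik
    let Q' := {A : Set (Atom (relArity L) (Fin k × ZMod 2)) |
      Module.finrank (ZMod 2) (flipSubmodule A) = i}
    have hlim := tendsto_proportion maxArity hk hm hm' C (fun _ M => AutIsoZ2Pow M i) Q Q' hne hC hQ
      hCQ (fun n M e he => autIsoZ2Pow_iff har he)
    refine ⟨Nat.card ↥(Q ∩ Q') / Nat.card Q, ?_, ?_, fun hm2 => ?_, by push_cast; exact hlim⟩
    · obtain ⟨A, hA, hAi⟩ := hex i hi hik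
      have : Nonempty ↥(Q ∩ Q') := ⟨⟨A, hA, hAi⟩⟩
      have : 0 < Nat.card ↥(Q ∩ Q') := Nat.card_pos
      positivity
    · rw [div_le_one (by exact_mod_cast hQ0)]
      exact_mod_cast Nat.card_mono Q.toFinite Set.inter_subset_left
    · rw [div_lt_one (by exact_mod_cast hQ0)]
      -- Since 2 < m ≤ 2k gives k ≥ 2, a second dimension is realised within `Q`, and this makes the
      -- ratio strictly less than 1.
      obtain ⟨i', h1', hk', hne'⟩ : ∃ i', 1 ≤ i' ∧ i' ≤ k ∧ i' ≠ i := by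
        rcases eq_or_ne i 1 with rfl | h
        · exact ⟨2, by omega, by omega, by omega⟩
        · exact ⟨1, le_rfl, hk, h.symm⟩
      obtain ⟨A, hA, hAi⟩ := hex i' h1' hk'
      have hss : Q ∩ Q' ⊂ Q := Set.ssubset_iff_subset_ne.2 ⟨Set.inter_subset_left, fun h =>
        hne' (hAi.symm.trans (h.superset hA).2)⟩
      exact_mod_cast Set.ncard_lt_ncard hss Q.toFinite

end Translation

theorem theorem1 (L : FirstOrder.Language) [L.IsRelational] [Finite L.Symbols]
    (maxArity : IsGreatest {j : ℕ | Nonempty (L.Relations j)} 2) (m : ℕ) (hm : 2 ≤ m) :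
    -- the class of structures with `spt ≥ m`
    (AlmostAll (SptGE L m) (fun _ M => sptStar M = evenCeil m ∧
        ∃ i, 1 ≤ i ∧ i ≤ evenCeil m / 2 ∧ AutIsoZ2Pow M i) ∧
      ∀ i, 1 ≤ i → i ≤ evenCeil m / 2 →
        ∃ a : ℚ, 0 < a ∧ a ≤ 1 ∧ (2 < m → a < 1) ∧
          Tendsto (proportion (SptGE L m) (fun _ M => AutIsoZ2Pow M i)) atTop (𝓝 (a : ℝ))) ∧
    -- the class of structures with `spt* ≥ m`
    (AlmostAll (SptStarGE L m) (fun _ M => sptStar M = evenCeil m ∧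
        ∃ i, 1 ≤ i ∧ i ≤ evenCeil m / 2 ∧ AutIsoZ2Pow M i) ∧
      ∀ i, 1 ≤ i → i ≤ evenCeil m / 2 →
        ∃ a : ℚ, 0 < a ∧ a ≤ 1 ∧ (2 < m → a < 1) ∧
          Tendsto (proportion (SptStarGE L m) (fun _ M => AutIsoZ2Pow M i)) atTop (𝓝 (a : ℝ))) := by
  obtain ⟨k, hk2, hk, hm1, hm2⟩ : ∃ k, evenCeil m = 2 * k ∧ 0 < k ∧ 2 * k ≤ m + 1 ∧ m ≤ 2 * k := by
    unfold evenCeil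
    split_ifs with h
    · obtain ⟨k, rfl⟩ := h
      exact ⟨k, by omega, by omega, by omega, by omega⟩
    · obtain ⟨k, rfl⟩ := Nat.not_even_iff_odd.1 h
      exact ⟨k + 1, by omega, by omega, by omega, by omega⟩
  have har : ∀ r, relArity L r ≤ 2 := fun r => maxArity.2 ⟨r.2⟩
  rw [hk2, Nat.mul_div_cancel_left k two_pos]
  constructor
  · refine limits_of_class maxArity hk hm1 hm2 (SptGE L m) {A | 1 ∈ flipSubmodule A} ?_
      (fun A hA => flipsCover_of_one_mem hA) (fun A hA => hA) ?_
    · intro n M hM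
      rw [sptStar_eq]
      exact le_ncard_moved_of_support ((le_spt_iff M).1 hM)
    · intro n M e he
      exact (le_spt_iff M).trans (he.exists_le_card_support_iff har hm2 hm1)
  · refine limits_of_class maxArity hk hm1 hm2 (SptStarGE L m) {A | FlipsCover A}
      (fun n M hM => hM) (fun A hA => hA) (fun A hA => flipsCover_of_one_mem hA) ?_
    intro n M e he
    refine iff_of_true ?_ he.flipsCover
    change m ≤ sptStar M
    rwa [sptStar_eq, he.ncard_moved]
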